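/- Let $(M,m,V,\varkappa)$ be a mechanical system with gyroscopic forces: $M$ is a smooth manifold, $m$ a smooth Riemannian metric on $M$, $V$ a smooth function on $M$, and $\varkappa$ a smooth closed 2-form on $M$. Let $p:TM\to M$ be the projection, $K(w)=\tfrac12 m(w,w)$ the kinetic energy, $\theta$ the 1-form on $TM$ given by $\theta_w(X)=m(w,Tp(X))$, and $\sigma=d\theta$. Let $X$ be the vector field on $TM$ determined by $i_X(\sigma+p^*\varkappa)=-d(K+V\circ p)$; a *motion* is a curve $x(t)=p(w(t))$, where $w(t)$ is an integral curve of $X$. Fix $h\in\mathbb R$, let $M_h=\{x\in M: V(x)<h\}$, let $m_h=2(h-V)m$ (a Riemannian metric on $M_h$), and let $\Pi_h$ be the operator taking 1-forms on $M_h$ to vector fields defined by $m_h(\Pi_h(\lambda),Y)=\lambda(Y)$. All curves are defined on open intervals. (1) Let $x(t)$ be a motion lying in $M_h$ and having energy $h$, that is, $K(\dot x(t))+V(x(t))=h$ for all $t$. Then $x$ can be parametrized by the (increasing) arclength $\tau$ of the metric $m_h$, and if $\bar x(\tau)$ denotes the same curve parametrized in this way, then $\bar x$ is a $C^2$ curve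 of $m_h$-speed $1$ on an open interval and $$\frac{D}{d\tau}\frac{d\bar x}{d\tau}=-\Pi_h\bigl(i_{d\bar x/d\tau}\,\varkappa\bigr),\qquad(*)$$ where the covariant derivative is that of the Levi-Civita connection of $m_h$. (2) Conversely, let $\bar x(\tau)$ be a $C^2$ curve in $M_h$ that is parametrized by the arclength $\tau$ of $m_h$ and satisfies $(*)$. Then there is a change of parameter $\tau=\tau(t)$, of class $C^2$ with $d\tau/dt>0$, mapping an open interval onto the domain of $\bar x$, such that the curve $x(t)=\bar x(\tau(t))$ is a motion of the system with energy $h$, that is, $K(\dot x)+V(x)=h$ along it. -/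

import Mathlib

open Set Bundle Manifold
open scoped ContDiff Topology

noncomputable section

namespace Gyro

/-! ### Differential forms on manifolds -/

section Forms

variable {F : Type*} [NormedAddCommGroup F] [NormedSpace ℝ F]
  {H : Type*} [TopologicalSpace H] (I : ModelWithCorners ℝ F H)
  {N : Type*} [TopologicalSpace N] [ChartedSpace H N]

/-- A (not necessarily smooth) differential `k`-form on the manifold `N`. -/
abbrev DiffForm (N : Type*) [TopologicalSpace N] [ChartedSpace H N] (k : ℕ) : Type _ :=
  ∀ x : N, TangentSpace I x [⋀^Fin k]→L[ℝ] ℝ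

variable {I} {k : ℕ}

/-- The coordinate expression of a `k`-form in the preferred chart around `x₀`, that is, its
pull-back under the inverse of this chart. -/
def DiffForm.inChart (α : DiffForm I N k) (x₀ : N) : F → F [⋀^Fin k]→L[ℝ] ℝ := fun y =>
  (α ((extChartAt I x₀).symm y)).compContinuousLinearMap
    (mfderivWithin 𝓘(ℝ, F) I (extChartAt I x₀).symm (range I) y)

/-- A form is smooth if all its coordinate expressions are smooth. -/
def DiffForm.IsSmooth (α : DiffForm I N k) : Prop :=
  ∀ x₀ : N, ContDiffOn ℝ ∞ (α.inChart x₀) (extChartAt I x₀).target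

/-- The exterior derivative of a form, computed at each point in the preferred chart around this
point (for smooth forms every other chart gives the same result). Normalization:
`dα(X, Y) = X α(Y) - Y α(X) - α([X, Y])` for a `1`-form. -/
def DiffForm.d (α : DiffForm I N k) : DiffForm I N (k + 1) := fun x =>
  (extDerivWithin (α.inChart x) (range I) (extChartAt I x x)).compContinuousLinearMap
    (mfderiv I 𝓘(ℝ, F) (extChartAt I x) x)

/-- A form is closed if its exterior derivative vanishes. -/
def DiffForm.IsClosed (α : DiffForm I N k) : Prop := ∀ x, α.d x = 0

/-- The inner product `i_u α` of a tangent vector `u` and a `2`-form `α`, i.e. the covector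
`Y ↦ α(u, Y)`. -/
def DiffForm.interior (α : DiffForm I N 2) {x : N} (u : TangentSpace I x) :
    TangentSpace I x →L[ℝ] ℝ :=
  (α x).toContinuousLinearMap ![u, 0] 1

theorem DiffForm.interior_apply (α : DiffForm I N 2) {x : N} (u Y : TangentSpace I x) :
    α.interior u Y = α x ![u, Y] := by
  change α x (Function.update ![u, 0] 1 Y) = _
  congr 1
  ext i
  fin_cases i <;> simp

end Forms

variable {E : Type*} [NormedAddCommGroup E] [NormedSpace ℝ E]
  {M : Type*} [TopologicalSpace M] [ChartedSpace E M]

/-! ### Metrics, musical isomorphism, covariant derivative along a curve -/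

/-- A field of bilinear forms on the tangent spaces of `M`; a Riemannian metric on an open subset
of `M` is regarded as such a field (with irrelevant values outside of this subset). -/
abbrev BilinField (E : Type*) [NormedAddCommGroup E] [NormedSpace ℝ E]
    (M : Type*) [TopologicalSpace M] [ChartedSpace E M] : Type _ :=
  ∀ x : M, TangentSpace 𝓘(ℝ, E) x →L[ℝ] TangentSpace 𝓘(ℝ, E) x →L[ℝ] ℝ

/-- The vector `v` with `g(v, Y) = l(Y)` for all `Y`. -/
def BilinField.sharp (g : BilinField E M) {x : M} (l : TangentSpace 𝓘(ℝ, E) x →L[ℝ] ℝ) :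
    TangentSpace 𝓘(ℝ, E) x :=
  (g x).inverse l

theorem BilinField.sharp_spec [FiniteDimensional ℝ E] (g : BilinField E M) {x : M}
    (hg : ∀ v : TangentSpace 𝓘(ℝ, E) x, v ≠ 0 → 0 < g x v v)
    (l : TangentSpace 𝓘(ℝ, E) x →L[ℝ] ℝ) (Y : TangentSpace 𝓘(ℝ, E) x) :
    g x (g.sharp l) Y = l Y := by
  let B : E →L[ℝ] E →L[ℝ] ℝ := g x
  have hB : ∀ v : E, v ≠ 0 → 0 < B v v := hg
  have hinj : Function.Injective B.toLinearMap := by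
    rw [← LinearMap.ker_eq_bot, LinearMap.ker_eq_bot']
    intro v hv
    by_contra h
    have h1 := hB v h
    have h2 : B v = 0 := hv
    simp [h2] at h1
  have hfin : Module.finrank ℝ E = Module.finrank ℝ (E →L[ℝ] ℝ) := by
    rw [← (LinearMap.toContinuousLinearMap (𝕜 := ℝ) (E := E) (F' := ℝ)).finrank_eq]
    exact (Subspace.dual_finrank_eq (K := ℝ) (V := E)).symm
  let e : E ≃L[ℝ] (E →L[ℝ] ℝ) :=
    (LinearEquiv.ofInjectiveOfFinrankEq B.toLinearMap hinj hfin).toContinuousLinearEquiv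
  have he : (e : E →L[ℝ] (E →L[ℝ] ℝ)) = B := by
    ext v w
    rfl
  have h3 : B (B.inverse l) = l := by
    have h4 : B.inverse = (e.symm : (E →L[ℝ] ℝ) →L[ℝ] E) := by
      rw [← he, ContinuousLinearMap.inverse_equiv]
    rw [h4, ← he]
    exact e.apply_symm_apply l
  exact DFunLike.congr_fun h3 Y

/-- The matrix of `g` in the preferred chart around `x₀`, as a function on the model space. -/
def BilinField.inChart (g : BilinField E M) (x₀ : M) : E → E →L[ℝ] E →L[ℝ] ℝ := fun y =>
  let D : E →L[ℝ] TangentSpace 𝓘(ℝ, E) ((extChartAt 𝓘(ℝ, E) x₀).symm y) :=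
    mfderiv 𝓘(ℝ, E) 𝓘(ℝ, E) (extChartAt 𝓘(ℝ, E) x₀).symm y
  (ContinuousLinearMap.precomp ℝ D).comp ((g ((extChartAt 𝓘(ℝ, E) x₀).symm y)).comp D)

/-- The Christoffel symbols of a metric `G` on an open subset of the model space: `Γ_y(u, v)` is
the vector such that, for all `w`,
`G(Γ(u, v), w) = (∂_u G(v, w) + ∂_v G(u, w) - ∂_w G(u, v)) / 2`. -/
def christoffel (G : E → E →L[ℝ] E →L[ℝ] ℝ) (y u v : E) : E :=
  (G y).inverse ((1 / 2 : ℝ) •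
    (fderiv ℝ G y u v + fderiv ℝ G y v u - ((fderiv ℝ G y).flip u).flip v))

/-- The velocity vector of a curve. -/
def velocity (E : Type*) [NormedAddCommGroup E] [NormedSpace ℝ E]
    {M : Type*} [TopologicalSpace M] [ChartedSpace E M] (c : ℝ → M) (t : ℝ) : TangentSpace 𝓘(ℝ, E) (c t) :=
  mfderiv 𝓘(ℝ, ℝ) 𝓘(ℝ, E) c t (1 : ℝ)

/-- The Levi-Civita covariant derivative `DW/dt` of a vector field `W` along a curve `c`, for the
metric `g`: in the preferred chart around `c t`, it is `dw/dt + Γ(dq/dt, w)`, where `q` and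
`w` are the coordinate expressions of `c` and `W`. -/
def covDerivAlong (g : BilinField E M) (c : ℝ → M) (W : ∀ t, TangentSpace 𝓘(ℝ, E) (c t))
    (t : ℝ) : TangentSpace 𝓘(ℝ, E) (c t) :=
  let φ := extChartAt 𝓘(ℝ, E) (c t)
  let q : ℝ → E := fun s => φ (c s)
  let w : ℝ → E := fun s => mfderiv 𝓘(ℝ, E) 𝓘(ℝ, E) φ (c s) (W s)
  (mfderiv 𝓘(ℝ, E) 𝓘(ℝ, E) φ (c t)).inverse
    (deriv w t + christoffel (g.inChart (c t)) (q t) (deriv q t) (w t))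

/-- The speed of a curve with respect to `g`. -/
def speed (g : BilinField E M) (c : ℝ → M) (t : ℝ) : ℝ :=
  Real.sqrt (g (c t) (velocity E c t) (velocity E c t))

/-- `y`, on the set `K`, is the curve `x`, given on the set `J`, parametrized by arclength of `g`:
there is an arclength function `s` of `x` on `J` (a function with `ds/dt = |dx/dt|_g`), it
maps `J` onto `K`, and `y(s(t)) = x(t)`. -/
def IsArclengthReparam (g : BilinField E M) (x : ℝ → M) (J : Set ℝ) (y : ℝ → M) (K : Set ℝ) :
    Prop :=
  ∃ s : ℝ → ℝ, (∀ t ∈ J, HasDerivAt s (speed g x t) t) ∧ s '' J = K ∧ ∀ t ∈ J, y (s t) = x t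

/-! ### Mechanical systems with gyroscopic forces -/

/-- A mechanical system with gyroscopic forces `(M, m, V, κ)` on the manifold `M`. -/
structure GyroSystem (E : Type*) [NormedAddCommGroup E] [NormedSpace ℝ E]
    (M : Type*) [TopologicalSpace M] [ChartedSpace E M] [IsManifold 𝓘(ℝ, E) ∞ M] where
  /-- the Riemannian metric `m` -/
  metric : ContMDiffRiemannianMetric 𝓘(ℝ, E) ∞ E (fun x : M => TangentSpace 𝓘(ℝ, E) x)
  /-- the potential `V` -/
  V : M → ℝ
  V_smooth : ContMDiff 𝓘(ℝ, E) 𝓘(ℝ, ℝ) ∞ V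
  /-- the form of gyroscopic forces `κ` -/
  κ : DiffForm 𝓘(ℝ, E) M 2
  κ_smooth : κ.IsSmooth
  κ_closed : κ.IsClosed

namespace GyroSystem

variable [IsManifold 𝓘(ℝ, E) ∞ M] (S : GyroSystem E M)

/-- The derivative of the bundle projection `p : TM → M` at `w`. -/
def dproj (w : TangentBundle 𝓘(ℝ, E) M) :
    TangentSpace 𝓘(ℝ, E).tangent w →L[ℝ] TangentSpace 𝓘(ℝ, E) w.proj :=
  mfderiv 𝓘(ℝ, E).tangent 𝓘(ℝ, E) (fun z : TangentBundle 𝓘(ℝ, E) M => z.proj) w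

/-- The total energy `H = K + V ∘ p` on `TM`, where `K(w) = m(w, w) / 2`. -/
def energy (w : TangentBundle 𝓘(ℝ, E) M) : ℝ :=
  (1 / 2 : ℝ) * S.metric.inner w.proj w.snd w.snd + S.V w.proj

/-- The Lagrange `1`-form on `TM`: `θ_w(X) = m(w, Tp(X))`. -/
def lagrangeForm : DiffForm 𝓘(ℝ, E).tangent (TangentBundle 𝓘(ℝ, E) M) 1 := fun w =>
  ContinuousAlternatingMap.ofSubsingleton ℝ (TangentSpace 𝓘(ℝ, E).tangent w) ℝ (0 : Fin 1)
    ((S.metric.inner w.proj w.snd).comp (dproj w))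

/-- The Lagrange `2`-form `σ = dθ` on `TM`. -/
def lagrangeTwoForm : DiffForm 𝓘(ℝ, E).tangent (TangentBundle 𝓘(ℝ, E) M) 2 :=
  S.lagrangeForm.d

/-- The pull-back `p^*κ` to `TM` of the form of gyroscopic forces. -/
def gyroPullback : DiffForm 𝓘(ℝ, E).tangent (TangentBundle 𝓘(ℝ, E) M) 2 := fun w =>
  (S.κ w.proj).compContinuousLinearMap (dproj w)

/-- `X` is the dynamical system corresponding to `S`, that is, the vector field on `TM` with
`i_X(σ + p^*κ) = -d(K + V ∘ p)`. -/
def IsDynamics (X : ∀ w : TangentBundle 𝓘(ℝ, E) M, TangentSpace 𝓘(ℝ, E).tangent w) : Prop :=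
  ∀ w, ∀ Y : TangentSpace 𝓘(ℝ, E).tangent w,
    (S.lagrangeTwoForm w + S.gyroPullback w) ![X w, Y] =
      -(mfderiv 𝓘(ℝ, E).tangent 𝓘(ℝ, ℝ) S.energy w Y : ℝ)

/-- The curve `x` is on `J` a motion of the system: the projection to `M` of an integral curve of
the dynamical system of `S`. -/
def IsMotion (x : ℝ → M) (J : Set ℝ) : Prop :=
  ∃ X : ∀ w : TangentBundle 𝓘(ℝ, E) M, TangentSpace 𝓘(ℝ, E).tangent w, S.IsDynamics X ∧
    ∃ w : ℝ → TangentBundle 𝓘(ℝ, E) M, IsMIntegralCurveOn w X J ∧ ∀ t ∈ J, (w t).proj = x t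

/-- The energy integral `K + V ∘ p = h` holds along the curve `x` on `J`. -/
def HasEnergy (h : ℝ) (x : ℝ → M) (J : Set ℝ) : Prop :=
  ∀ t ∈ J, S.energy ⟨x t, velocity E x t⟩ = h

/-- The region of possible motions `M_h = {V < h}`. -/
def region (h : ℝ) : Set M := {x | S.V x < h}

/-- The Jacobi metric `m_h = 2 (h - V) m`, a Riemannian metric on `M_h`. -/
def jacobiMetric (h : ℝ) : BilinField E M := fun x => (2 * (h - S.V x)) • S.metric.inner x

/-- The equation `D/dτ (dy/dτ) = -Π_h(i_{dy/dτ} κ)` holds along the curve `y` on `K`; the covariant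
derivative is that of the Jacobi metric `m_h`, and `m_h(Π_h(λ), Y) = λ(Y)`. -/
def CurvatureEquation (h : ℝ) (y : ℝ → M) (K : Set ℝ) : Prop :=
  ∀ τ ∈ K, covDerivAlong (S.jacobiMetric h) y (velocity E y) τ =
    -(S.jacobiMetric h).sharp (S.κ.interior (velocity E y τ))

end GyroSystem

end Gyro

end

set_option synthInstance.maxHeartbeats 200000

/-! In coordinates `θ = G_y(v, dy)`, and the equation defining the dynamics splits in two: vertical
test vectors force the base component of `X` at `w` to be `w` itself, and horizontal ones then give
Newton's equation `m(D x'/dt, ξ) + κ(x', ξ) + dV(ξ) = 0` (`dynamics_equation_iff`). A motion is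
therefore a curve whose velocity lift integrates `X`, that is, a solution of Newton's equation.

Put `f = 2(h - V)`, so that `m_h = f m`. Energy `h` means `m(x', x') = f`, hence the `m_h`-speed of
`x` is `f` and arclength satisfies `dτ/dt = f`. For a curve of unit `m_h`-speed, with lowered
accelerations `A`, the conformal change of metric gives `f A_{m_h} = A_m - df/2`, where `A_m` is
taken along the curve reparametrized by `dτ/dt = f` (`loweredAccel_conformal`). Since `-df/2 = dV`,
and `κ(x', ξ)` is linear in the velocity, the left side of Newton's equation is `f` times that of
the lowered equation `(*)`. As `f > 0` on `M_h`, the two equations are equivalent at each time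
(`newtonAt_comp_iff`). Part (1) uses one direction and part (2) the other; in (2) the energy
relation comes from unit speed.

The dynamical field is not assumed continuous, so the `C²` regularity of motions must be proved:
Newton's equation, read in one fixed chart, expresses the second derivative continuously through
position and velocity (`IsMotion.contMDiffOn`). This rests on its invariance under changes of chart.
-/

noncomputable section

namespace Gyro

/-! ### Lowered acceleration in a vector space: naturality and conformal change -/

section Coordinates

variable {E : Type*} [NormedAddCommGroup E] [NormedSpace ℝ E]

/-- The covariant acceleration of a curve with position `y`, velocity `v` and second derivative `b`,
for a metric `G` on an open subset of a vector space, lowered by `G` and evaluated on `ξ`. -/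
def loweredAccel (G : E → E →L[ℝ] E →L[ℝ] ℝ) (y v b ξ : E) : ℝ :=
  G y b ξ + fderiv ℝ G y v v ξ - (1 / 2 : ℝ) * fderiv ℝ G y ξ v v

theorem fderiv_bilin_apply {G : E → E →L[ℝ] E →L[ℝ] ℝ} {y : E} (hG : DifferentiableAt ℝ G y)
    (a u v : E) : fderiv ℝ (fun z => G z u v) y a = fderiv ℝ G y a u v := by
  have h1 : HasFDerivAt (fun z => G z u v) _ y :=
    (hG.hasFDerivAt.clm_apply (hasFDerivAt_const u y)).clm_apply (hasFDerivAt_const v y)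
  rw [h1.fderiv]
  simp

theorem fderiv_pullback_bilin {G₀ G₁ : E → E →L[ℝ] E →L[ℝ] ℝ} {ψ : E → E} {y : E}
    (hψ : ContDiffAt ℝ 2 ψ y) (hG₀ : DifferentiableAt ℝ G₀ y) (hG₁ : DifferentiableAt ℝ G₁ (ψ y))
    (h : ∀ᶠ z in 𝓝 y, ∀ u v, G₀ z u v = G₁ (ψ z) (fderiv ℝ ψ z u) (fderiv ℝ ψ z v)) (a u v : E) :
    fderiv ℝ G₀ y a u v =
      fderiv ℝ G₁ (ψ y) (fderiv ℝ ψ y a) (fderiv ℝ ψ y u) (fderiv ℝ ψ y v)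
      + G₁ (ψ y) (fderiv ℝ (fderiv ℝ ψ) y a u) (fderiv ℝ ψ y v)
      + G₁ (ψ y) (fderiv ℝ ψ y u) (fderiv ℝ (fderiv ℝ ψ) y a v) := by
  rw [← fderiv_bilin_apply hG₀]
  have h1 : (fun z => G₀ z u v) =ᶠ[𝓝 y]
      fun z => G₁ (ψ z) (fderiv ℝ ψ z u) (fderiv ℝ ψ z v) := h.mono fun z hz => hz u v
  rw [h1.fderiv_eq]
  have hD : HasFDerivAt (fderiv ℝ ψ) (fderiv ℝ (fderiv ℝ ψ) y) y :=
    ((hψ.fderiv_right (m := 1) le_rfl).differentiableAt one_ne_zero).hasFDerivAt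
  have hψ' : HasFDerivAt ψ (fderiv ℝ ψ y) y := (hψ.differentiableAt two_ne_zero).hasFDerivAt
  have h2 := hG₁.hasFDerivAt.comp (G := E →L[ℝ] E →L[ℝ] ℝ) y hψ'
  have h3 := (h2.clm_apply (hD.clm_apply (hasFDerivAt_const u y))).clm_apply
    (hD.clm_apply (hasFDerivAt_const v y))
  refine (DFunLike.congr_fun h3.fderiv a).trans ?_
  simp
  ring

/-- The lowered covariant acceleration is natural under coordinate changes. -/
theorem loweredAccel_pullback {G₀ G₁ : E → E →L[ℝ] E →L[ℝ] ℝ} {ψ : E → E} {y : E}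
    (hψ : ContDiffAt ℝ 2 ψ y) (hG₀ : DifferentiableAt ℝ G₀ y) (hG₁ : DifferentiableAt ℝ G₁ (ψ y))
    (hsymm : ∀ u v, G₁ (ψ y) u v = G₁ (ψ y) v u)
    (h : ∀ᶠ z in 𝓝 y, ∀ u v, G₀ z u v = G₁ (ψ z) (fderiv ℝ ψ z u) (fderiv ℝ ψ z v)) (v b ξ : E) :
    loweredAccel G₀ y v b ξ =
      loweredAccel G₁ (ψ y) (fderiv ℝ ψ y v) (fderiv ℝ (fderiv ℝ ψ) y v v + fderiv ℝ ψ y b)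
        (fderiv ℝ ψ y ξ) := by
  -- Differentiating the pulled-back metric produces terms in `ψ''(v, ξ)` and `ψ''(ξ, v)`. They
  -- cancel because `ψ''` and `G₁` are symmetric, and only `G₁(ψ''(v, v), ψ' ξ)` survives.
  have h2 := hψ.isSymmSndFDerivAt (by simp) v ξ
  simp only [loweredAccel, fderiv_pullback_bilin hψ hG₀ hG₁ h, h.self_of_nhds, h2, map_add,
    add_apply]
  rw [hsymm (fderiv ℝ (fderiv ℝ ψ) y ξ v)]
  ring

theorem bilin_inverse_apply [FiniteDimensional ℝ E] {B : E →L[ℝ] E →L[ℝ] ℝ}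
    (hB : ∀ v, v ≠ 0 → 0 < B v v) (l : E →L[ℝ] ℝ) (Y : E) : B (B.inverse l) Y = l Y :=
  BilinField.sharp_spec (M := E) (fun _ => B) (x := (0 : E)) hB l Y

/-- The `inverse` of a non-invertible map is `0` by convention. The formula for `inverse` would then
make every functional vanish, so `E` would be trivial and `B` invertible after all. -/
theorem bilin_isInvertible [FiniteDimensional ℝ E] {B : E →L[ℝ] E →L[ℝ] ℝ}
    (hB : ∀ v, v ≠ 0 → 0 < B v v) : B.IsInvertible := by
  by_contra hn
  have h0 := bilin_inverse_apply hB
  rw [ContinuousLinearMap.inverse_of_not_isInvertible hn] at h0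
  have h1 : ∀ l : E →L[ℝ] ℝ, l = 0 := fun l => by
    ext Y
    simpa using (h0 l Y).symm
  have h2 : Subsingleton E := ⟨fun a b => by
    by_contra hab
    have := hB (a - b) (sub_ne_zero.2 hab)
    simp [h1 (B (a - b))] at this⟩
  refine hn ⟨ContinuousLinearEquiv.equivOfInverse B 0 (fun _ => Subsingleton.elim _ _)
    (fun l => by rw [h1 l, map_zero, map_zero]), rfl⟩

theorem bilin_injective {B : E →L[ℝ] E →L[ℝ] ℝ}
    (hB : ∀ v, v ≠ 0 → 0 < B v v) {a b : E} (h : ∀ ξ, B a ξ = B b ξ) : a = b := by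
  by_contra hab
  have := hB (a - b) (sub_ne_zero.2 hab)
  simp [h] at this

theorem bilin_add_christoffel [FiniteDimensional ℝ E] {G : E → E →L[ℝ] E →L[ℝ] ℝ} {y : E}
    (hG : ∀ v, v ≠ 0 → 0 < G y v v) (v b ξ : E) :
    G y (b + christoffel G y v v) ξ = loweredAccel G y v b ξ := by
  rw [map_add, add_apply, christoffel, bilin_inverse_apply hG, loweredAccel]
  simp
  ring

theorem hasFDerivAt_fun_smul {F : Type*} [NormedAddCommGroup F] [NormedSpace ℝ F] {f : E → ℝ}
    {G : E → F} {y : E} (hf : DifferentiableAt ℝ f y) (hG : DifferentiableAt ℝ G y) :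
    HasFDerivAt (fun z => f z • G z) (f y • fderiv ℝ G y + (fderiv ℝ f y).smulRight (G y)) y :=
  hf.hasFDerivAt.smul hG.hasFDerivAt

/-- The lowered covariant acceleration for the conformal metric `f G`, at `f`-times slower speed. -/
theorem loweredAccel_conformal {G : E → E →L[ℝ] E →L[ℝ] ℝ} {f : E → ℝ} {y : E}
    (hG : DifferentiableAt ℝ G y) (hf : DifferentiableAt ℝ f y)
    {v : E} (hv : f y * G y v v = 1) (b ξ : E) :
    f y * loweredAccel (fun z => f z • G z) y v b ξ =
      loweredAccel G y (f y • v) (f y ^ 2 • b + (f y * fderiv ℝ f y v) • v) ξ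
        - (1 / 2 : ℝ) * fderiv ℝ f y ξ := by
  have h1 := hasFDerivAt_fun_smul (F := E →L[ℝ] E →L[ℝ] ℝ) hf hG
  simp only [loweredAccel, h1.fderiv]
  simp
  -- The only mismatch is `f G(v, v) df(ξ) / 2` against `df(ξ) / 2`; the normalization of `v`
  -- removes it.
  linear_combination (-(1 / 2 : ℝ) * fderiv ℝ f y ξ) * hv

end Coordinates

/-! ### Changes of parameter on an interval -/

section Reparametrization

theorem exists_primitive {J : Set ℝ} (hJo : IsOpen J) (hJc : J.OrdConnected) {g : ℝ → ℝ}
    (hg : ContinuousOn g J) : ∃ s : ℝ → ℝ, ∀ t ∈ J, HasDerivAt s (g t) t := by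
  rcases J.eq_empty_or_nonempty with rfl | ⟨t₀, ht₀⟩
  · exact ⟨0, by simp⟩
  refine ⟨fun t => ∫ r in t₀..t, g r, fun t ht => ?_⟩
  have hsub : uIcc t₀ t ⊆ J := hJc.uIcc_subset ht₀ ht
  exact intervalIntegral.integral_hasDerivAt_right ((hg.mono hsub).intervalIntegrable)
    (hg.stronglyMeasurableAtFilter hJo t ht) (hg.continuousAt (hJo.mem_nhds ht))

variable {J : Set ℝ} {s g : ℝ → ℝ}

theorem strictMonoOn_of_hasDerivAt_pos (hJc : J.OrdConnected)
    (hs : ∀ t ∈ J, HasDerivAt s (g t) t) (hg : ∀ t ∈ J, 0 < g t) : StrictMonoOn s J :=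
  strictMonoOn_of_deriv_pos hJc.convex (fun t ht => (hs t ht).continuousAt.continuousWithinAt)
    fun t ht => by
      rw [(hs t (interior_subset ht)).deriv]
      exact hg t (interior_subset ht)

theorem ordConnected_image_of_hasDerivAt (hJc : J.OrdConnected)
    (hs : ∀ t ∈ J, HasDerivAt s (g t) t) : (s '' J).OrdConnected :=
  (hJc.isPreconnected.image s
    fun t ht => (hs t ht).continuousAt.continuousWithinAt).ordConnected

theorem isOpen_image_of_hasDerivAt_pos (hJo : IsOpen J) (hJc : J.OrdConnected)
    (hs : ∀ t ∈ J, HasDerivAt s (g t) t) (hg : ∀ t ∈ J, 0 < g t) : IsOpen (s '' J) := by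
  have hmono := strictMonoOn_of_hasDerivAt_pos hJc hs hg
  rw [isOpen_iff_mem_nhds]
  rintro _ ⟨t, ht, rfl⟩
  obtain ⟨ε, hε, hsub⟩ := Metric.isOpen_iff.1 hJo t ht
  have ha : t - ε / 2 ∈ J := hsub (by rw [Real.ball_eq_Ioo]; constructor <;> linarith)
  have hb : t + ε / 2 ∈ J := hsub (by rw [Real.ball_eq_Ioo]; constructor <;> linarith)
  exact Filter.mem_of_superset
    (Icc_mem_nhds (hmono ha ht (by linarith)) (hmono ht hb (by linarith)))
    ((ordConnected_image_of_hasDerivAt hJc hs).out (mem_image_of_mem s ha) (mem_image_of_mem s hb))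

/-- No continuity of `g` is needed: the inverse is continuous because it is strictly monotone with
open image `J`, and differentiability follows from that of `s`. -/
theorem exists_leftInverse_of_hasDerivAt_pos (hJo : IsOpen J) (hJc : J.OrdConnected)
    (hs : ∀ t ∈ J, HasDerivAt s (g t) t) (hg : ∀ t ∈ J, 0 < g t) :
    ∃ σ : ℝ → ℝ, (∀ t ∈ J, σ (s t) = t) ∧ ∀ t ∈ J, HasDerivAt σ (g t)⁻¹ (s t) := by
  have hmono := strictMonoOn_of_hasDerivAt_pos hJc hs hg
  have hσ : ∀ t ∈ J, Function.invFunOn s J (s t) = t := hmono.injOn.leftInvOn_invFunOn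
  refine ⟨Function.invFunOn s J, hσ, fun t ht => ?_⟩
  have hK : s '' J ∈ 𝓝 (s t) :=
    (isOpen_image_of_hasDerivAt_pos hJo hJc hs hg).mem_nhds (mem_image_of_mem s ht)
  have hσmono : StrictMonoOn (Function.invFunOn s J) (s '' J) := by
    rintro _ ⟨a, ha, rfl⟩ _ ⟨b, hb, rfl⟩ hab
    rw [hσ a ha, hσ b hb]
    exact (hmono.lt_iff_lt ha hb).1 hab
  have himage : Function.invFunOn s J '' (s '' J) = J := by
    rw [image_image]
    exact (image_congr hσ).trans (image_id' J)
  refine HasDerivAt.of_local_left_inverse (f := s) ?_ ?_ (hg t ht).ne' ?_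
  · refine hσmono.continuousAt_of_image_mem_nhds hK ?_
    rw [himage, hσ t ht]
    exact hJo.mem_nhds ht
  · rw [hσ t ht]
    exact hs t ht
  · filter_upwards [hK]
    rintro _ ⟨a, ha, rfl⟩
    rw [hσ a ha]

/-- Bootstrap for the autonomous equation `σ' = p(σ)`: continuity of `σ` makes `σ'` continuous, and
then `σ'` is `C¹` as a composite of `C¹` maps. -/
theorem contDiffOn_two_of_hasDerivAt_comp {K : Set ℝ} {σ p : ℝ → ℝ} (hK : IsOpen K)
    (hp : ContDiffOn ℝ 1 p J) (hmaps : MapsTo σ K J)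
    (hσ : ∀ τ ∈ K, HasDerivAt σ (p (σ τ)) τ) : ContDiffOn ℝ 2 σ K := by
  have hd : DifferentiableOn ℝ σ K := fun τ hτ => (hσ τ hτ).differentiableAt.differentiableWithinAt
  have hderiv : ∀ τ ∈ K, deriv σ τ = (p ∘ σ) τ := fun τ hτ => (hσ τ hτ).deriv
  have h1 : ContDiffOn ℝ 1 σ K := by
    rw [show (1 : WithTop ℕ∞) = 0 + 1 from rfl, contDiffOn_succ_iff_deriv_of_isOpen hK]
    exact ⟨hd, by simp, contDiffOn_zero.2
      ((hp.continuousOn.comp hd.continuousOn hmaps).congr hderiv)⟩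
  rw [show (2 : WithTop ℕ∞) = 1 + 1 from rfl, contDiffOn_succ_iff_deriv_of_isOpen hK]
  exact ⟨hd, by simp, (hp.comp h1 hmaps).congr hderiv⟩

end Reparametrization

/-! ### Chart derivatives, transition maps and smoothness in charts -/

section Charts

variable {E : Type*} [NormedAddCommGroup E] [NormedSpace ℝ E]
  {M : Type*} [TopologicalSpace M] [ChartedSpace E M]

variable (E) in
/-- The derivative at `x` of the preferred chart around `x₀`, as an endomorphism of `E`. -/
def chartDeriv (x₀ x : M) : E →L[ℝ] E := mfderiv 𝓘(ℝ, E) 𝓘(ℝ, E) (extChartAt 𝓘(ℝ, E) x₀) x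

/-- The derivative at `y` of the inverse of the preferred chart around `x₀`, as an endomorphism
of `E`. -/
def chartSymmDeriv (x₀ : M) (y : E) : E →L[ℝ] E :=
  mfderiv 𝓘(ℝ, E) 𝓘(ℝ, E) (extChartAt 𝓘(ℝ, E) x₀).symm y

/-- The bilinear form `g x`, regarded as a bilinear form on `E`. -/
def BilinField.form (g : BilinField E M) (x : M) : E →L[ℝ] E →L[ℝ] ℝ := g x

/-- The alternating form `α x`, regarded as a function on `E × E`. -/
def DiffForm.form (α : DiffForm 𝓘(ℝ, E) M 2) (x : M) (u v : E) : ℝ :=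
  (α x : E [⋀^Fin 2]→L[ℝ] ℝ) ![u, v]

theorem BilinField.inChart_apply (g : BilinField E M) (x₀ : M) (y u v : E) :
    g.inChart x₀ y u v =
      g.form ((extChartAt 𝓘(ℝ, E) x₀).symm y) (chartSymmDeriv x₀ y u) (chartSymmDeriv x₀ y v) := rfl

theorem DiffForm.inChart_apply (α : DiffForm 𝓘(ℝ, E) M 2) (x₀ : M) (y u v : E) :
    α.inChart x₀ y ![u, v] =
      α.form ((extChartAt 𝓘(ℝ, E) x₀).symm y) (chartSymmDeriv x₀ y u) (chartSymmDeriv x₀ y v) := by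
  rw [DiffForm.form, DiffForm.inChart, modelWithCornersSelf_coe, range_id, mfderivWithin_univ]
  change (α ((extChartAt 𝓘(ℝ, E) x₀).symm y) : E [⋀^Fin 2]→L[ℝ] ℝ) _ = _
  congr 1
  ext i
  fin_cases i <;> rfl

theorem eventually_mem_extChartAt_target {x₀ : M} {y : E} {s : Set M} (hs : IsOpen s)
    (hy : y ∈ (extChartAt 𝓘(ℝ, E) x₀).target) (hys : (extChartAt 𝓘(ℝ, E) x₀).symm y ∈ s) :
    ∀ᶠ z in 𝓝 y, z ∈ (extChartAt 𝓘(ℝ, E) x₀).target ∧ (extChartAt 𝓘(ℝ, E) x₀).symm z ∈ s :=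
  Filter.Eventually.and ((isOpen_extChartAt_target x₀).mem_nhds hy)
    ((continuousAt_extChartAt_symm'' hy).preimage_mem_nhds (hs.mem_nhds hys))

section C1

variable [IsManifold 𝓘(ℝ, E) 1 M]

theorem chartSymmDeriv_chartDeriv {x₀ x : M}
    (hx : x ∈ (extChartAt 𝓘(ℝ, E) x₀).source) (u : E) :
    chartSymmDeriv x₀ (extChartAt 𝓘(ℝ, E) x₀ x) (chartDeriv E x₀ x u) = u := by
  have h := mfderivWithin_extChartAt_symm_comp_mfderiv_extChartAt' (I := 𝓘(ℝ, E)) hx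
  rw [modelWithCornersSelf_coe, range_id, mfderivWithin_univ] at h
  exact DFunLike.congr_fun h u

theorem chartDeriv_chartSymmDeriv {x₀ : M} {y : E}
    (hy : y ∈ (extChartAt 𝓘(ℝ, E) x₀).target) (u : E) :
    chartDeriv E x₀ ((extChartAt 𝓘(ℝ, E) x₀).symm y) (chartSymmDeriv x₀ y u) = u := by
  have h := mfderiv_extChartAt_comp_mfderivWithin_extChartAt_symm (I := 𝓘(ℝ, E)) hy
  rw [modelWithCornersSelf_coe, range_id, mfderivWithin_univ] at h
  exact DFunLike.congr_fun h u

theorem chartDeriv_self (x : M) : chartDeriv E x x = ContinuousLinearMap.id ℝ E :=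
  mfderiv_extChartAt_self

theorem mdifferentiableAt_extChartAt_symm {x₀ : M} {y : E}
    (hy : y ∈ (extChartAt 𝓘(ℝ, E) x₀).target) :
    MDifferentiableAt 𝓘(ℝ, E) 𝓘(ℝ, E) (extChartAt 𝓘(ℝ, E) x₀).symm y := by
  have h := mdifferentiableWithinAt_extChartAt_symm (I := 𝓘(ℝ, E)) hy
  rwa [modelWithCornersSelf_coe, range_id, mdifferentiableWithinAt_univ] at h

theorem BilinField.inChart_chartDeriv (g : BilinField E M) {x₀ x : M}
    (hx : x ∈ (extChartAt 𝓘(ℝ, E) x₀).source) (u v : E) :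
    g.inChart x₀ (extChartAt 𝓘(ℝ, E) x₀ x) (chartDeriv E x₀ x u) (chartDeriv E x₀ x v) =
      g.form x u v := by
  rw [BilinField.inChart_apply, chartSymmDeriv_chartDeriv hx, chartSymmDeriv_chartDeriv hx,
    (extChartAt 𝓘(ℝ, E) x₀).left_inv hx]

theorem BilinField.inChart_self (g : BilinField E M) (x₀ : M) :
    g.inChart x₀ (extChartAt 𝓘(ℝ, E) x₀ x₀) = g.form x₀ := by
  ext u v
  have h := g.inChart_chartDeriv (mem_extChartAt_source (I := 𝓘(ℝ, E)) x₀) u v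
  rwa [chartDeriv_self] at h

theorem DiffForm.inChart_chartDeriv (α : DiffForm 𝓘(ℝ, E) M 2) {x₀ x : M}
    (hx : x ∈ (extChartAt 𝓘(ℝ, E) x₀).source) (u v : E) :
    α.inChart x₀ (extChartAt 𝓘(ℝ, E) x₀ x) ![chartDeriv E x₀ x u, chartDeriv E x₀ x v] =
      α.form x u v := by
  rw [DiffForm.inChart_apply, chartSymmDeriv_chartDeriv hx, chartSymmDeriv_chartDeriv hx,
    (extChartAt 𝓘(ℝ, E) x₀).left_inv hx]

/-- The transition function from the preferred chart around `x₀` to the one around `x₁`. -/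
def chartTransition (x₀ x₁ : M) : E → E :=
  extChartAt 𝓘(ℝ, E) x₁ ∘ (extChartAt 𝓘(ℝ, E) x₀).symm

theorem fderiv_chartTransition {x₀ x₁ : M} {y : E} (hy : y ∈ (extChartAt 𝓘(ℝ, E) x₀).target)
    (hy' : (extChartAt 𝓘(ℝ, E) x₀).symm y ∈ (extChartAt 𝓘(ℝ, E) x₁).source) (u : E) :
    fderiv ℝ (chartTransition x₀ x₁) y u =
      chartDeriv E x₁ ((extChartAt 𝓘(ℝ, E) x₀).symm y) (chartSymmDeriv x₀ y u) := by
  rw [← mfderiv_eq_fderiv, chartTransition]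
  rw [extChartAt_source] at hy'
  rw [mfderiv_comp y (mdifferentiableAt_extChartAt hy') (mdifferentiableAt_extChartAt_symm hy)]
  rfl

theorem fderiv_chartTransition_chartDeriv {x₀ x₁ x : M}
    (hx₀ : x ∈ (extChartAt 𝓘(ℝ, E) x₀).source) (hx₁ : x ∈ (extChartAt 𝓘(ℝ, E) x₁).source) (u : E) :
    fderiv ℝ (chartTransition x₀ x₁) (extChartAt 𝓘(ℝ, E) x₀ x) (chartDeriv E x₀ x u) =
      chartDeriv E x₁ x u := by
  have hinv := (extChartAt 𝓘(ℝ, E) x₀).left_inv hx₀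
  rw [fderiv_chartTransition ((extChartAt 𝓘(ℝ, E) x₀).map_source hx₀) (by rwa [hinv]), hinv,
    chartSymmDeriv_chartDeriv hx₀]

theorem BilinField.inChart_transition (g : BilinField E M) {x₀ x₁ : M} {y : E}
    (hy : y ∈ (extChartAt 𝓘(ℝ, E) x₀).target)
    (hy' : (extChartAt 𝓘(ℝ, E) x₀).symm y ∈ (extChartAt 𝓘(ℝ, E) x₁).source) (u v : E) :
    g.inChart x₀ y u v = g.inChart x₁ (chartTransition x₀ x₁ y)
      (fderiv ℝ (chartTransition x₀ x₁) y u) (fderiv ℝ (chartTransition x₀ x₁) y v) := by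
  rw [fderiv_chartTransition hy hy', fderiv_chartTransition hy hy']
  exact (g.inChart_chartDeriv hy' _ _).symm

end C1

theorem contDiffAt_chartTransition [IsManifold 𝓘(ℝ, E) ∞ M] {x₀ x₁ : M} {y : E}
    (hy : y ∈ (extChartAt 𝓘(ℝ, E) x₀).target)
    (hy' : (extChartAt 𝓘(ℝ, E) x₀).symm y ∈ (extChartAt 𝓘(ℝ, E) x₁).source) :
    ContDiffAt ℝ ∞ (chartTransition x₀ x₁) y := by
  rw [← contMDiffAt_iff_contDiffAt]
  rw [extChartAt_source] at hy'
  exact (contMDiffAt_extChartAt' hy').comp y ((contMDiffOn_extChartAt_symm x₀).contMDiffAt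
    ((isOpen_extChartAt_target x₀).mem_nhds hy))

theorem contDiffOn_comp_extChartAt_symm [IsManifold 𝓘(ℝ, E) ∞ M] {V : M → ℝ}
    (hV : ContMDiff 𝓘(ℝ, E) 𝓘(ℝ, ℝ) ∞ V) (x₀ : M) :
    ContDiffOn ℝ ∞ (V ∘ (extChartAt 𝓘(ℝ, E) x₀).symm) (extChartAt 𝓘(ℝ, E) x₀).target := by
  rw [← contMDiffOn_iff_contDiffOn]
  exact hV.comp_contMDiffOn (contMDiffOn_extChartAt_symm x₀)

theorem extChartAt_symm_mem_chartAt_source {x₀ : M} {y : E}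
    (hy : y ∈ (extChartAt 𝓘(ℝ, E) x₀).target) :
    (extChartAt 𝓘(ℝ, E) x₀).symm y ∈ (chartAt E x₀).source := by
  rw [← extChartAt_source 𝓘(ℝ, E)]
  exact (extChartAt 𝓘(ℝ, E) x₀).map_target hy

theorem trivializationAt_symm_apply [IsManifold 𝓘(ℝ, E) 1 M] {x₀ : M} {y : E}
    (hy : y ∈ (extChartAt 𝓘(ℝ, E) x₀).target) (u : E) :
    (trivializationAt E (TangentSpace 𝓘(ℝ, E) : M → Type _) x₀).toPartialEquiv.symm
        ((extChartAt 𝓘(ℝ, E) x₀).symm y, u) =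
      TotalSpace.mk' E ((extChartAt 𝓘(ℝ, E) x₀).symm y) (chartSymmDeriv x₀ y u) := by
  have hmem := extChartAt_symm_mem_chartAt_source hy
  have h := TangentBundle.symmL_trivializationAt (I := 𝓘(ℝ, E)) hmem
  rw [modelWithCornersSelf_coe, range_id, mfderivWithin_univ,
    (extChartAt 𝓘(ℝ, E) x₀).right_inv hy] at h
  have h' := DFunLike.congr_fun h u
  rw [Trivialization.symmL_apply _ hmem] at h'
  refine (Trivialization.mk_symm _ hmem u).symm.trans ?_
  exact congrArg (TotalSpace.mk' E _) h'

/-- Coordinate vector fields are the images of constant vectors under the inverse local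
trivialization of `TM`, which is smooth. Evaluating the metric on them yields its coefficients. -/
theorem contMDiffOn_chartSymmDeriv [IsManifold 𝓘(ℝ, E) ∞ M] (x₀ : M) (u : E) :
    ContMDiffOn 𝓘(ℝ, E) 𝓘(ℝ, E).tangent ∞ (fun y => (TotalSpace.mk' E
      ((extChartAt 𝓘(ℝ, E) x₀).symm y) (chartSymmDeriv x₀ y u) : TangentBundle 𝓘(ℝ, E) M))
      (extChartAt 𝓘(ℝ, E) x₀).target := by
  have h1 : ContMDiffOn (𝓘(ℝ, E).prod 𝓘(ℝ, E)) (𝓘(ℝ, E).prod 𝓘(ℝ, E)) ∞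
      (trivializationAt E (TangentSpace 𝓘(ℝ, E) : M → Type _) x₀).toOpenPartialHomeomorph.symm
      (trivializationAt E (TangentSpace 𝓘(ℝ, E) : M → Type _) x₀).target :=
    Trivialization.contMDiffOn_symm _
  have h2 : ContMDiffOn 𝓘(ℝ, E) (𝓘(ℝ, E).prod 𝓘(ℝ, E)) ∞
      (fun y : E => ((extChartAt 𝓘(ℝ, E) x₀).symm y, u)) (extChartAt 𝓘(ℝ, E) x₀).target :=
    (contMDiffOn_extChartAt_symm x₀).prodMk contMDiffOn_const
  refine (h1.comp h2 fun y hy => ?_).congr fun y hy => ?_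
  · exact ⟨extChartAt_symm_mem_chartAt_source hy, mem_univ _⟩
  · exact (trivializationAt_symm_apply hy u).symm

theorem contDiffOn_inChart_metric [IsManifold 𝓘(ℝ, E) ∞ M] [FiniteDimensional ℝ E]
    (g : ContMDiffRiemannianMetric 𝓘(ℝ, E) ∞ E (fun x : M => TangentSpace 𝓘(ℝ, E) x)) (x₀ : M) :
    ContDiffOn ℝ ∞ (BilinField.inChart g.inner x₀) (extChartAt 𝓘(ℝ, E) x₀).target := by
  refine contDiffOn_clm_apply.2 fun u => contDiffOn_clm_apply.2 fun v => ?_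
  rw [← contMDiffOn_iff_contDiffOn]
  intro y hy
  have h1 := ContMDiffWithinAt.clm_bundle_apply₂ (F₁ := E) (F₂ := E) (F₃ := ℝ)
    (E₁ := fun x : M => TangentSpace 𝓘(ℝ, E) x) (E₂ := fun x : M => TangentSpace 𝓘(ℝ, E) x)
    (E₃ := Bundle.Trivial M ℝ)
    (g.contMDiff.contMDiffAt.comp_contMDiffWithinAt y (contMDiffOn_extChartAt_symm x₀ y hy))
    (contMDiffOn_chartSymmDeriv x₀ u y hy) (contMDiffOn_chartSymmDeriv x₀ v y hy)
  exact ((contMDiffWithinAt_totalSpace).1 h1).2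

theorem DiffForm.IsSmooth.continuousOn_inChart {α : DiffForm 𝓘(ℝ, E) M 2} (hα : α.IsSmooth)
    (x₀ : M) : ContinuousOn (α.inChart x₀) (extChartAt 𝓘(ℝ, E) x₀).target :=
  (hα x₀).continuousOn

end Charts

/-! ### Preferred charts of the tangent bundle -/

section TangentBundle

variable {E : Type*} [NormedAddCommGroup E] [NormedSpace ℝ E]
  {M : Type*} [TopologicalSpace M] [ChartedSpace E M] [IsManifold 𝓘(ℝ, E) 1 M]

theorem tangentBundle_extChartAt_apply (w z : TangentBundle 𝓘(ℝ, E) M)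
    (hz : z.proj ∈ (extChartAt 𝓘(ℝ, E) w.proj).source) :
    extChartAt 𝓘(ℝ, E).tangent w z =
      (extChartAt 𝓘(ℝ, E) w.proj z.proj, chartDeriv E w.proj z.proj z.snd) := by
  rw [extChartAt_source] at hz
  have h := DFunLike.congr_fun
    (TangentBundle.continuousLinearMapAt_trivializationAt (I := 𝓘(ℝ, E)) hz) z.snd
  rw [Trivialization.continuousLinearMapAt_apply, Trivialization.coe_linearMapAt_of_mem _ hz] at h
  exact Prod.ext rfl h

theorem tangentBundle_extChartAt_symm_apply (w : TangentBundle 𝓘(ℝ, E) M) {y : E}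
    (hy : y ∈ (extChartAt 𝓘(ℝ, E) w.proj).target) (v : E) :
    (extChartAt 𝓘(ℝ, E).tangent w).symm (y, v) =
      TotalSpace.mk' E ((extChartAt 𝓘(ℝ, E) w.proj).symm y) (chartSymmDeriv w.proj y v) :=
  trivializationAt_symm_apply hy v

theorem tangentBundle_mem_extChartAt_target (w : TangentBundle 𝓘(ℝ, E) M) (p : E × E) :
    p ∈ (extChartAt 𝓘(ℝ, E).tangent w).target ↔ p.1 ∈ (extChartAt 𝓘(ℝ, E) w.proj).target := by
  rw [extChartAt_target, extChartAt_target]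
  simp only [ModelWithCorners.tangent, mfld_simps, Prod.map_id, range_id]
  exact TangentBundle.mem_chart_target_iff p w

theorem tangentBundle_mem_extChartAt_source (w z : TangentBundle 𝓘(ℝ, E) M) :
    z ∈ (extChartAt 𝓘(ℝ, E).tangent w).source ↔
      z.proj ∈ (extChartAt 𝓘(ℝ, E) w.proj).source := by
  simp

theorem range_tangent : range (𝓘(ℝ, E).tangent : ModelProd E E → E × E) = univ :=
  ModelWithCorners.range_eq_univ _

end TangentBundle

/-! ### The projection and the Lagrange 1-form in coordinates -/

section Dynamics

variable {E : Type*} [NormedAddCommGroup E] [NormedSpace ℝ E]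
  {M : Type*} [TopologicalSpace M] [ChartedSpace E M] [IsManifold 𝓘(ℝ, E) ∞ M]

theorem mdifferentiableAt_tangentBundle_extChartAt_symm {w : TangentBundle 𝓘(ℝ, E) M} {z : E × E}
    (hz : z ∈ (extChartAt 𝓘(ℝ, E).tangent w).target) :
    MDifferentiableAt 𝓘(ℝ, E × E) 𝓘(ℝ, E).tangent (extChartAt 𝓘(ℝ, E).tangent w).symm z := by
  have h := mdifferentiableWithinAt_extChartAt_symm (I := 𝓘(ℝ, E).tangent) hz
  rwa [range_tangent, mdifferentiableWithinAt_univ] at h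

theorem mdifferentiable_tangentBundle_proj :
    MDifferentiable 𝓘(ℝ, E).tangent 𝓘(ℝ, E) (fun z : TangentBundle 𝓘(ℝ, E) M => z.proj) :=
  (contMDiff_proj (n := 1) (TangentSpace 𝓘(ℝ, E) : M → Type _)).mdifferentiable one_ne_zero

theorem dproj_comp_mfderiv_symm {w : TangentBundle 𝓘(ℝ, E) M} {z : E × E}
    (hz : z.1 ∈ (extChartAt 𝓘(ℝ, E) w.proj).target) (a : E × E) :
    (GyroSystem.dproj ((extChartAt 𝓘(ℝ, E).tangent w).symm z)
      (mfderiv 𝓘(ℝ, E × E) 𝓘(ℝ, E).tangent (extChartAt 𝓘(ℝ, E).tangent w).symm z a) : E) =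
      chartSymmDeriv w.proj z.1 a.1 := by
  have hz' := (tangentBundle_mem_extChartAt_target w z).2 hz
  have h1 := mfderiv_comp z (mdifferentiable_tangentBundle_proj _)
    (mdifferentiableAt_tangentBundle_extChartAt_symm hz')
  have h2 : (fun z : TangentBundle 𝓘(ℝ, E) M => z.proj) ∘ (extChartAt 𝓘(ℝ, E).tangent w).symm
      =ᶠ[𝓝 z] (extChartAt 𝓘(ℝ, E) w.proj).symm ∘ (Prod.fst : E × E → E) := by
    filter_upwards [continuous_fst.continuousAt.preimage_mem_nhds
      ((isOpen_extChartAt_target w.proj).mem_nhds hz)] with p hp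
    exact congrArg TotalSpace.proj (tangentBundle_extChartAt_symm_apply w hp p.2)
  have h3 := mfderiv_comp (I' := 𝓘(ℝ, E)) z (mdifferentiableAt_extChartAt_symm hz)
    (differentiableAt_fst (𝕜 := ℝ) (p := z)).mdifferentiableAt
  rw [h2.mfderiv_eq, h3, mfderiv_eq_fderiv, fderiv_fst] at h1
  exact (DFunLike.congr_fun h1 a).symm

/-- The fibre component of a point of the tangent bundle, regarded as a vector of `E`. -/
def fibreVec (w : TangentBundle 𝓘(ℝ, E) M) : E := w.snd

theorem tangentBundle_extChartAt_self (w : TangentBundle 𝓘(ℝ, E) M) :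
    extChartAt 𝓘(ℝ, E).tangent w w = (extChartAt 𝓘(ℝ, E) w.proj w.proj, fibreVec w) := by
  rw [tangentBundle_extChartAt_apply w w (mem_extChartAt_source _), chartDeriv_self]
  rfl

/-- At the centre of a preferred chart the derivative of that chart is the identity, on `M` as well
as on `TM`; so `Tp` is literally its coordinate expression, the first projection. -/
theorem dproj_apply (w : TangentBundle 𝓘(ℝ, E) M) (a : E × E) :
    (GyroSystem.dproj w a : E) = a.1 := by
  have h1 := mfderiv_comp w (mdifferentiableAt_extChartAt (I := 𝓘(ℝ, E)) (mem_chart_source E w.proj))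
    (mdifferentiable_tangentBundle_proj w)
  have h2 : extChartAt 𝓘(ℝ, E) w.proj ∘ (fun z : TangentBundle 𝓘(ℝ, E) M => z.proj)
      =ᶠ[𝓝 w] (Prod.fst : E × E → E) ∘ extChartAt 𝓘(ℝ, E).tangent w := by
    filter_upwards [extChartAt_source_mem_nhds (I := 𝓘(ℝ, E).tangent) w] with z hz
    rw [tangentBundle_mem_extChartAt_source] at hz
    rw [Function.comp_apply, Function.comp_apply, tangentBundle_extChartAt_apply w z hz]
  have h3 := mfderiv_comp w
    (differentiableAt_fst (𝕜 := ℝ) (E := E) (F := E)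
      (p := extChartAt 𝓘(ℝ, E).tangent w w)).mdifferentiableAt
    (mdifferentiableAt_extChartAt (mem_chart_source _ w))
  rw [h2.mfderiv_eq, h3, mfderiv_eq_fderiv, fderiv_fst, mfderiv_extChartAt_self,
    mfderiv_extChartAt_self] at h1
  exact (DFunLike.congr_fun h1 a).symm

namespace GyroSystem

variable (S : GyroSystem E M)

/-- The metric in the preferred chart around `x₀`. -/
def chartMetric (x₀ : M) : E → E →L[ℝ] E →L[ℝ] ℝ := BilinField.inChart S.metric.inner x₀

/-- The potential in the preferred chart around `x₀`. -/
def chartPotential (x₀ : M) : E → ℝ := S.V ∘ (extChartAt 𝓘(ℝ, E) x₀).symm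

theorem chartMetric_symm (x₀ : M) (y u v : E) :
    S.chartMetric x₀ y u v = S.chartMetric x₀ y v u :=
  S.metric.symm _ _ _

theorem chartMetric_pos {x₀ : M} {y : E} (hy : y ∈ (extChartAt 𝓘(ℝ, E) x₀).target) (v : E)
    (hv : v ≠ 0) : 0 < S.chartMetric x₀ y v v := by
  refine S.metric.pos _ _ fun h => hv ?_
  have h' : chartSymmDeriv x₀ y v = 0 := h
  rw [← chartDeriv_chartSymmDeriv hy v, h', map_zero]

theorem contDiffOn_chartMetric [FiniteDimensional ℝ E] (x₀ : M) :
    ContDiffOn ℝ ∞ (S.chartMetric x₀) (extChartAt 𝓘(ℝ, E) x₀).target :=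
  contDiffOn_inChart_metric S.metric x₀

theorem differentiableAt_chartMetric [FiniteDimensional ℝ E] {x₀ : M} {y : E}
    (hy : y ∈ (extChartAt 𝓘(ℝ, E) x₀).target) : DifferentiableAt ℝ (S.chartMetric x₀) y :=
  (S.contDiffOn_chartMetric x₀).differentiableOn (by simp) |>.differentiableAt
    ((isOpen_extChartAt_target x₀).mem_nhds hy)

theorem contDiffOn_chartPotential (x₀ : M) :
    ContDiffOn ℝ ∞ (S.chartPotential x₀) (extChartAt 𝓘(ℝ, E) x₀).target :=
  contDiffOn_comp_extChartAt_symm S.V_smooth x₀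

theorem differentiableAt_chartPotential {x₀ : M} {y : E}
    (hy : y ∈ (extChartAt 𝓘(ℝ, E) x₀).target) : DifferentiableAt ℝ (S.chartPotential x₀) y :=
  (S.contDiffOn_chartPotential x₀).differentiableOn (by simp) |>.differentiableAt
    ((isOpen_extChartAt_target x₀).mem_nhds hy)

theorem lagrangeForm_inChart {w : TangentBundle 𝓘(ℝ, E) M} {z : E × E}
    (hz : z.1 ∈ (extChartAt 𝓘(ℝ, E) w.proj).target) :
    S.lagrangeForm.inChart w z =
      ContinuousAlternatingMap.ofSubsingletonLIE (𝕜 := ℝ) (E := E × E) (F := ℝ) (0 : Fin 1)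
        ((S.chartMetric w.proj z.1 z.2).comp (ContinuousLinearMap.fst ℝ E E)) := by
  ext a
  rw [DiffForm.inChart, range_tangent, mfderivWithin_univ]
  -- The form lives on a fibre depending on the base point, so equal points are substituted as free
  -- variables instead of being rewritten in place.
  have key : ∀ (p q : TangentBundle 𝓘(ℝ, E) M) (b c : E), p = q → b = c →
      BilinField.form S.metric.inner p.proj p.snd b =
      BilinField.form S.metric.inner q.proj q.snd c := by
    rintro p q b c rfl rfl
    rfl
  exact key _ _ _ _ (tangentBundle_extChartAt_symm_apply w hz z.2)
    (dproj_comp_mfderiv_symm hz (a 0))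

end GyroSystem

end Dynamics

/-! ### The Lagrange 2-form, the energy and Newton's equation -/

section Dynamics

variable {E : Type*} [NormedAddCommGroup E] [NormedSpace ℝ E] [FiniteDimensional ℝ E]
  {M : Type*} [TopologicalSpace M] [ChartedSpace E M] [IsManifold 𝓘(ℝ, E) ∞ M]

namespace GyroSystem

variable (S : GyroSystem E M)

theorem hasFDerivAt_chartMetric_apply {x₀ : M} {z : E × E}
    (hz : z.1 ∈ (extChartAt 𝓘(ℝ, E) x₀).target) :
    HasFDerivAt (fun p : E × E => S.chartMetric x₀ p.1 p.2)
      ((S.chartMetric x₀ z.1).comp (ContinuousLinearMap.snd ℝ E E) +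
        ((fderiv ℝ (S.chartMetric x₀) z.1).comp (ContinuousLinearMap.fst ℝ E E)).flip z.2) z := by
  have h1 := (S.differentiableAt_chartMetric hz).hasFDerivAt.comp (G := E →L[ℝ] E →L[ℝ] ℝ) z
    (hasFDerivAt_fst (𝕜 := ℝ) (E := E) (F := E) (p := z))
  exact h1.clm_apply hasFDerivAt_snd

/-- Product rule for `G_y(v, ·)`: one term varies the base point, the other the fibre coordinate.
Antisymmetrizing this derivative gives `σ`. -/
theorem hasFDerivAt_lagrangeForm_inChart {w : TangentBundle 𝓘(ℝ, E) M} {z : E × E}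
    (hz : z.1 ∈ (extChartAt 𝓘(ℝ, E) w.proj).target) :
    ∃ L : E × E →L[ℝ] (E × E) [⋀^Fin 1]→L[ℝ] ℝ, HasFDerivAt (S.lagrangeForm.inChart w) L z ∧
      ∀ (a : E × E) (c : Fin 1 → E × E), L a c =
        fderiv ℝ (S.chartMetric w.proj) z.1 a.1 z.2 (c 0).1 +
          S.chartMetric w.proj z.1 a.2 (c 0).1 := by
  let R : (E →L[ℝ] ℝ) →L[ℝ] (E × E →L[ℝ] ℝ) :=
    ContinuousLinearMap.precomp ℝ (ContinuousLinearMap.fst ℝ E E)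
  let A : (E × E →L[ℝ] ℝ) →L[ℝ] (E × E) [⋀^Fin 1]→L[ℝ] ℝ :=
    (ContinuousAlternatingMap.ofSubsingletonLIE (𝕜 := ℝ) (E := E × E) (F := ℝ)
      (0 : Fin 1)).toContinuousLinearEquiv
  have h1 := (A.comp R).hasFDerivAt.comp z (S.hasFDerivAt_chartMetric_apply hz)
  refine ⟨_, h1.congr_of_eventuallyEq ?_, fun a c => ?_⟩
  · filter_upwards [continuous_fst.continuousAt.preimage_mem_nhds
      ((isOpen_extChartAt_target w.proj).mem_nhds hz)] with p hp
    exact S.lagrangeForm_inChart hp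
  · exact add_comm _ _

theorem lagrangeTwoForm_apply (w : TangentBundle 𝓘(ℝ, E) M) (X Y : E × E) :
    (S.lagrangeTwoForm w : (E × E) [⋀^Fin 2]→L[ℝ] ℝ) ![X, Y] =
      fderiv ℝ (S.chartMetric w.proj) (extChartAt 𝓘(ℝ, E) w.proj w.proj) X.1 (fibreVec w) Y.1 +
        S.chartMetric w.proj (extChartAt 𝓘(ℝ, E) w.proj w.proj) X.2 Y.1 -
      (fderiv ℝ (S.chartMetric w.proj) (extChartAt 𝓘(ℝ, E) w.proj w.proj) Y.1 (fibreVec w) X.1 +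
        S.chartMetric w.proj (extChartAt 𝓘(ℝ, E) w.proj w.proj) Y.2 X.1) := by
  have hw := tangentBundle_extChartAt_self w
  obtain ⟨L, hL, hLa⟩ := S.hasFDerivAt_lagrangeForm_inChart (w := w)
    (z := (extChartAt 𝓘(ℝ, E) w.proj w.proj, fibreVec w)) (mem_extChartAt_target w.proj)
  have h1 : (S.lagrangeTwoForm w : (E × E) [⋀^Fin 2]→L[ℝ] ℝ) ![X, Y] =
      extDeriv (S.lagrangeForm.inChart w) (extChartAt 𝓘(ℝ, E).tangent w w) ![X, Y] := by
    rw [lagrangeTwoForm, DiffForm.d, range_tangent, extDerivWithin_univ, mfderiv_extChartAt_self]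
    rfl
  rw [h1, hw, extDeriv, hL.fderiv, ContinuousAlternatingMap.alternatizeUncurryFin_apply, Fin.sum_univ_two]
  simp [hLa, Fin.removeNth]
  ring

/-- The derivative of the energy, as a function on `E × E`. -/
def energyDeriv (w : TangentBundle 𝓘(ℝ, E) M) (Y : E × E) : ℝ :=
  mfderiv 𝓘(ℝ, E).tangent 𝓘(ℝ, ℝ) S.energy w Y

theorem energyDeriv_apply (w : TangentBundle 𝓘(ℝ, E) M) (Y : E × E) :
    S.energyDeriv w Y =
      (1 / 2 : ℝ) * fderiv ℝ (S.chartMetric w.proj) (extChartAt 𝓘(ℝ, E) w.proj w.proj)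
          Y.1 (fibreVec w) (fibreVec w) +
        S.chartMetric w.proj (extChartAt 𝓘(ℝ, E) w.proj w.proj) (fibreVec w) Y.2 +
        fderiv ℝ (S.chartPotential w.proj) (extChartAt 𝓘(ℝ, E) w.proj w.proj) Y.1 := by
  have hw := tangentBundle_extChartAt_self w
  let Ĥ : E × E → ℝ := fun p =>
    (1 / 2 : ℝ) * S.chartMetric w.proj p.1 p.2 p.2 + S.chartPotential w.proj p.1
  have hz : (extChartAt 𝓘(ℝ, E) w.proj w.proj) ∈ (extChartAt 𝓘(ℝ, E) w.proj).target :=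
    mem_extChartAt_target w.proj
  have hH : HasFDerivAt Ĥ _ (extChartAt 𝓘(ℝ, E) w.proj w.proj, fibreVec w) :=
    (((S.hasFDerivAt_chartMetric_apply hz).clm_apply hasFDerivAt_snd).const_mul (1 / 2 : ℝ)).add
      ((S.differentiableAt_chartPotential hz).hasFDerivAt.comp
        (extChartAt 𝓘(ℝ, E) w.proj w.proj, fibreVec w)
        (f := Prod.fst) (hasFDerivAt_fst (𝕜 := ℝ) (E := E) (F := E)))
  have hE : S.energy =ᶠ[𝓝 w] Ĥ ∘ extChartAt 𝓘(ℝ, E).tangent w := by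
    filter_upwards [extChartAt_source_mem_nhds (I := 𝓘(ℝ, E).tangent) w] with z hz
    rw [tangentBundle_mem_extChartAt_source] at hz
    have h1 := BilinField.inChart_chartDeriv S.metric.inner hz z.snd z.snd
    have h2 := (extChartAt 𝓘(ℝ, E) w.proj).left_inv hz
    rw [Function.comp_apply, tangentBundle_extChartAt_apply w z hz]
    simp only [Ĥ, energy, chartMetric, chartPotential, Function.comp_apply, h2]
    exact congrArg (fun r : ℝ => (1 / 2 : ℝ) * r + S.V z.proj) h1.symm
  have hH' : MDifferentiableAt 𝓘(ℝ, E × E) 𝓘(ℝ, ℝ) Ĥ (extChartAt 𝓘(ℝ, E).tangent w w) := by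
    rw [hw]
    exact hH.differentiableAt.mdifferentiableAt
  have h1 := mfderiv_comp w hH' (mdifferentiableAt_extChartAt (mem_chart_source _ w))
  rw [energyDeriv, hE.mfderiv_eq, h1, mfderiv_extChartAt_self, hw, mfderiv_eq_fderiv, hH.fderiv]
  change (1 / 2 : ℝ) * (S.chartMetric w.proj _ (fibreVec w) Y.2 +
    (S.chartMetric w.proj _ Y.2 (fibreVec w) +
      fderiv ℝ (S.chartMetric w.proj) _ Y.1 (fibreVec w) (fibreVec w))) +
    fderiv ℝ (S.chartPotential w.proj) _ Y.1 = _
  rw [S.chartMetric_symm _ _ Y.2]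
  ring

/-- The left hand side of Newton's equation `m(D v/dt, ξ) + κ(v, ξ) + dV(ξ) = 0` in the preferred
chart around `x₀`, at the position `y`, the velocity `v` and the second derivative `b`. -/
def newtonDefect (x₀ : M) (y v b ξ : E) : ℝ :=
  loweredAccel (S.chartMetric x₀) y v b ξ + S.κ.inChart x₀ y ![v, ξ] +
    fderiv ℝ (S.chartPotential x₀) y ξ

omit [FiniteDimensional ℝ E] in
theorem gyroPullback_apply (w : TangentBundle 𝓘(ℝ, E) M) (X Y : E × E) :
    (S.gyroPullback w : (E × E) [⋀^Fin 2]→L[ℝ] ℝ) ![X, Y] =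
      S.κ.inChart w.proj (extChartAt 𝓘(ℝ, E) w.proj w.proj) ![X.1, Y.1] := by
  have h := S.κ.inChart_chartDeriv (mem_extChartAt_source (I := 𝓘(ℝ, E)) w.proj) X.1 Y.1
  simp only [chartDeriv_self, ContinuousLinearMap.id_apply] at h
  rw [h]
  refine congrArg (S.κ w.proj : E [⋀^Fin 2]→L[ℝ] ℝ) (funext fun i => ?_)
  fin_cases i
  exacts [dproj_apply w X, dproj_apply w Y]

theorem dynamics_equation_iff (w : TangentBundle 𝓘(ℝ, E) M) (X : E × E) :
    (∀ Y : E × E, (S.lagrangeTwoForm w + S.gyroPullback w : (E × E) [⋀^Fin 2]→L[ℝ] ℝ) ![X, Y] =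
      -S.energyDeriv w Y) ↔
    X.1 = fibreVec w ∧
      ∀ ξ, S.newtonDefect w.proj (extChartAt 𝓘(ℝ, E) w.proj w.proj) (fibreVec w) X.2 ξ = 0 := by
  have hpos := S.chartMetric_pos (mem_extChartAt_target (I := 𝓘(ℝ, E)) w.proj)
  have key : ∀ Y : E × E,
      (S.lagrangeTwoForm w + S.gyroPullback w : (E × E) [⋀^Fin 2]→L[ℝ] ℝ) ![X, Y] =
      (S.lagrangeTwoForm w : (E × E) [⋀^Fin 2]→L[ℝ] ℝ) ![X, Y] +
      (S.gyroPullback w : (E × E) [⋀^Fin 2]→L[ℝ] ℝ) ![X, Y] := fun Y => rfl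
  have hz : S.κ.inChart w.proj (extChartAt 𝓘(ℝ, E) w.proj w.proj) ![X.1, 0] = 0 :=
    ContinuousAlternatingMap.map_coord_zero _ 1 rfl
  simp only [key, S.lagrangeTwoForm_apply, S.gyroPullback_apply, S.energyDeriv_apply,
    newtonDefect, loweredAccel]
  constructor
  · intro h
    have hX : X.1 = fibreVec w := by
      refine bilin_injective hpos fun ξ => ?_
      -- On a vertical test vector only `G(X.1, ξ) = G(v, ξ)` remains.
      have h1 := h (0, ξ)
      simp only [map_zero, hz, zero_apply, S.chartMetric_symm _ _ ξ] at h1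
      linarith
    refine ⟨hX, fun ξ => ?_⟩
    -- On a horizontal test vector, `-DG(ξ)(v, v)` from `σ` and half of it from the energy combine
    -- into the `-1/2` of the lowered acceleration.
    have h1 := h (ξ, 0)
    simp only [hX, map_zero, zero_apply] at h1
    linarith
  · rintro ⟨hX, h⟩ Y
    have h1 := h Y.1
    rw [hX, S.chartMetric_symm _ _ Y.2]
    linarith

end GyroSystem

end Dynamics

/-! ### Curves in charts and their velocity lifts -/

section Curves

theorem two_le_infty : (2 : WithTop ℕ∞) ≤ ∞ :=
  WithTop.coe_le_coe.2 (le_top (a := (2 : ℕ∞)))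

variable {E : Type*} [NormedAddCommGroup E] [NormedSpace ℝ E]
  {M : Type*} [TopologicalSpace M] [ChartedSpace E M]

variable (E) in
/-- The velocity of a curve, regarded as a vector of `E`. -/
def velocityVec (x : ℝ → M) (t : ℝ) : E := velocity E x t

/-- A curve in the preferred chart around `x₀`. -/
def chartCurve (x₀ : M) (x : ℝ → M) : ℝ → E := fun t => extChartAt 𝓘(ℝ, E) x₀ (x t)

variable (E) in
/-- The lift of a curve to the tangent bundle by its velocity. -/
def tangentLift (x : ℝ → M) (t : ℝ) : TangentBundle 𝓘(ℝ, E) M := ⟨x t, velocity E x t⟩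

theorem velocityVec_congr {x x' : ℝ → M} {t : ℝ} (h : x =ᶠ[𝓝 t] x') :
    velocityVec E x t = velocityVec E x' t := by
  rw [velocityVec, velocityVec, velocity, velocity, h.mfderiv_eq]
  rfl

theorem chartCurve_congr {x₀ : M} {x x' : ℝ → M} {t : ℝ} (h : x =ᶠ[𝓝 t] x') :
    (chartCurve x₀ x : ℝ → E) =ᶠ[𝓝 t] chartCurve x₀ x' :=
  h.fun_comp (extChartAt 𝓘(ℝ, E) x₀)

theorem hasDerivAt_chartCurve [IsManifold 𝓘(ℝ, E) 1 M] {x₀ : M} {x : ℝ → M} {t : ℝ}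
    (hx : MDifferentiableAt 𝓘(ℝ, ℝ) 𝓘(ℝ, E) x t) (ht : x t ∈ (extChartAt 𝓘(ℝ, E) x₀).source) :
    HasDerivAt (chartCurve x₀ x : ℝ → E) (chartDeriv E x₀ (x t) (velocityVec E x t)) t := by
  rw [extChartAt_source] at ht
  have h := (mdifferentiableAt_extChartAt (I := 𝓘(ℝ, E)) ht).hasMFDerivAt.comp t hx.hasMFDerivAt
  have h' : HasFDerivAt (chartCurve x₀ x : ℝ → E)
      ((chartDeriv E x₀ (x t)).comp (show ℝ →L[ℝ] E from mfderiv 𝓘(ℝ, ℝ) 𝓘(ℝ, E) x t)) t :=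
    h.hasFDerivAt
  exact h'.hasDerivAt

theorem deriv_chartCurve_self [IsManifold 𝓘(ℝ, E) 1 M] {x : ℝ → M} {t : ℝ}
    (hx : MDifferentiableAt 𝓘(ℝ, ℝ) 𝓘(ℝ, E) x t) :
    deriv (chartCurve (x t) x : ℝ → E) t = velocityVec E x t := by
  rw [(hasDerivAt_chartCurve hx (mem_extChartAt_source _)).deriv, chartDeriv_self]
  rfl

theorem eventually_mem_chart_source {x₀ : M} {x : ℝ → M} {t : ℝ} (hx : ContinuousAt x t)
    (ht : x t ∈ (extChartAt 𝓘(ℝ, E) x₀).source) :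
    ∀ᶠ s in 𝓝 t, x s ∈ (extChartAt 𝓘(ℝ, E) x₀).source :=
  hx.preimage_mem_nhds ((isOpen_extChartAt_source x₀).mem_nhds ht)

theorem contDiffAt_chartCurve [IsManifold 𝓘(ℝ, E) ∞ M] {x₀ : M} {x : ℝ → M} {t : ℝ}
    (hx : ContMDiffAt 𝓘(ℝ, ℝ) 𝓘(ℝ, E) 2 x t) (ht : x t ∈ (extChartAt 𝓘(ℝ, E) x₀).source) :
    ContDiffAt ℝ 2 (chartCurve x₀ x : ℝ → E) t := by
  rw [extChartAt_source] at ht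
  rw [← contMDiffAt_iff_contDiffAt]
  exact ((contMDiffAt_extChartAt' (n := ∞) ht).of_le two_le_infty).comp t hx

theorem eventually_mdifferentiableAt [IsManifold 𝓘(ℝ, E) ∞ M] {x : ℝ → M} {t : ℝ}
    (hx : ContMDiffAt 𝓘(ℝ, ℝ) 𝓘(ℝ, E) 2 x t) :
    ∀ᶠ s in 𝓝 t, MDifferentiableAt 𝓘(ℝ, ℝ) 𝓘(ℝ, E) x s := by
  have : IsManifold 𝓘(ℝ, E) 2 M := .of_le (n := ∞) two_le_infty
  exact ((contMDiffAt_iff_contMDiffAt_nhds (by simp)).1 hx).mono fun s hs => hs.mdifferentiableAt two_ne_zero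

theorem tangentBundle_extChartAt_tangentLift [IsManifold 𝓘(ℝ, E) 1 M] {x : ℝ → M} {s : ℝ}
    (w : TangentBundle 𝓘(ℝ, E) M) (hx : MDifferentiableAt 𝓘(ℝ, ℝ) 𝓘(ℝ, E) x s)
    (hs : x s ∈ (extChartAt 𝓘(ℝ, E) w.proj).source) :
    extChartAt 𝓘(ℝ, E).tangent w (tangentLift E x s) =
      (chartCurve w.proj x s, deriv (chartCurve w.proj x : ℝ → E) s) := by
  rw [tangentBundle_extChartAt_apply w _ hs, (hasDerivAt_chartCurve hx hs).deriv]
  rfl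

/-- In the chart of `TM` centred at its own value the lift is `(q, q')`, and the inverse of this
chart has identity derivative at the centre; so the derivative of the lift is `(q', q'')`. -/
theorem hasMFDerivAt_tangentLift [IsManifold 𝓘(ℝ, E) ∞ M] {x : ℝ → M} {t : ℝ}
    (hx : ContMDiffAt 𝓘(ℝ, ℝ) 𝓘(ℝ, E) 2 x t) :
    HasMFDerivAt 𝓘(ℝ, ℝ) 𝓘(ℝ, E).tangent (tangentLift E x) t
      ((1 : ℝ →L[ℝ] ℝ).smulRight ((velocityVec E x t,
        deriv (deriv (chartCurve (x t) x : ℝ → E)) t) : E × E)) := by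
  set w := tangentLift E x t with hw
  set q : ℝ → E := chartCurve (x t) x with hq
  have hq2 : ContDiffAt ℝ 2 q t := contDiffAt_chartCurve hx (mem_extChartAt_source _)
  have h1 : HasDerivAt q (velocityVec E x t) t := by
    rw [← deriv_chartCurve_self (hx.mdifferentiableAt two_ne_zero)]
    exact (hq2.differentiableAt two_ne_zero).hasDerivAt
  have h2 : HasDerivAt (deriv q) (deriv (deriv q) t) t :=
    (ContDiffAt.differentiableAt (ContDiffAt.derivWithin hq2 (m := 1) le_rfl) one_ne_zero).hasDerivAt
  have h3 := (h1.prodMk h2).hasFDerivAt.hasMFDerivAt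
  have hw' : extChartAt 𝓘(ℝ, E).tangent w w = (q t, deriv q t) :=
    tangentBundle_extChartAt_tangentLift w (hx.mdifferentiableAt two_ne_zero)
      (mem_extChartAt_source _)
  have h4 := (mdifferentiableAt_tangentBundle_extChartAt_symm
    (mem_extChartAt_target (I := 𝓘(ℝ, E).tangent) w)).hasMFDerivAt
  have h5 := mfderivWithin_range_extChartAt_symm (I := 𝓘(ℝ, E).tangent) (x := w)
  rw [range_tangent, mfderivWithin_univ] at h5
  rw [h5, hw'] at h4
  have h6 := (h4.comp t h3).congr_of_eventuallyEq (f₁ := tangentLift E x) ?_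
  · exact h6
  · filter_upwards [eventually_mdifferentiableAt hx, eventually_mem_chart_source (E := E)
      hx.continuousAt (mem_extChartAt_source (x t))] with s hs hs'
    have h7 := tangentBundle_extChartAt_tangentLift w hs hs'
    refine Eq.trans ?_ (congrArg (extChartAt 𝓘(ℝ, E).tangent w).symm h7)
    rw [(extChartAt 𝓘(ℝ, E).tangent w).left_inv]
    rwa [tangentBundle_mem_extChartAt_source]

theorem contMDiffAt_two_of_chartCurve {x : ℝ → M} {t : ℝ} (hc : ContinuousAt x t)
    (h : ContDiffAt ℝ 2 (chartCurve (x t) x : ℝ → E) t) :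
    ContMDiffAt 𝓘(ℝ, ℝ) 𝓘(ℝ, E) 2 x t := by
  rw [contMDiffAt_iff_target]
  exact ⟨hc, h.contMDiffAt⟩

theorem chartCurve_transition {x₀ x₁ : M} {x : ℝ → M} {s : ℝ}
    (hs : x s ∈ (extChartAt 𝓘(ℝ, E) x₀).source) :
    chartTransition x₀ x₁ (chartCurve x₀ x s : E) = chartCurve x₁ x s := by
  rw [chartTransition, Function.comp_apply, chartCurve, (extChartAt 𝓘(ℝ, E) x₀).left_inv hs]
  rfl

end Curves

/-! ### Newton's equation along a curve -/

section Motions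

variable {E : Type*} [NormedAddCommGroup E] [NormedSpace ℝ E]
  {M : Type*} [TopologicalSpace M] [ChartedSpace E M] [IsManifold 𝓘(ℝ, E) ∞ M]

/-- The law of transformation of the second derivative of a curve under a change of charts. -/
theorem deriv_deriv_chartCurve_transition {x₀ x₁ : M} {x : ℝ → M} {t : ℝ}
    (hx : ∀ᶠ s in 𝓝 t, MDifferentiableAt 𝓘(ℝ, ℝ) 𝓘(ℝ, E) x s)
    (h₀ : x t ∈ (extChartAt 𝓘(ℝ, E) x₀).source) (h₁ : x t ∈ (extChartAt 𝓘(ℝ, E) x₁).source)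
    (hd : DifferentiableAt ℝ (deriv (chartCurve x₀ x : ℝ → E)) t) :
    deriv (deriv (chartCurve x₁ x : ℝ → E)) t =
      fderiv ℝ (fderiv ℝ (chartTransition x₀ x₁)) (chartCurve x₀ x t : E)
          (deriv (chartCurve x₀ x) t) (deriv (chartCurve x₀ x) t) +
        fderiv ℝ (chartTransition x₀ x₁) (chartCurve x₀ x t : E)
          (deriv (deriv (chartCurve x₀ x)) t) := by
  have hc : ContinuousAt x t := hx.self_of_nhds.continuousAt
  have hev : deriv (chartCurve x₁ x : ℝ → E) =ᶠ[𝓝 t] fun s =>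
      fderiv ℝ (chartTransition x₀ x₁) (chartCurve x₀ x s : E) (deriv (chartCurve x₀ x) s) := by
    filter_upwards [hx, eventually_mem_chart_source hc h₀, eventually_mem_chart_source hc h₁]
      with s hs hs₀ hs₁
    rw [(hasDerivAt_chartCurve hs hs₀).deriv, (hasDerivAt_chartCurve hs hs₁).deriv]
    exact (fderiv_chartTransition_chartDeriv hs₀ hs₁ _).symm
  rw [hev.deriv_eq]
  have hψ : ContDiffAt ℝ 2 (chartTransition x₀ x₁) (chartCurve x₀ x t : E) := by
    refine (contDiffAt_chartTransition ((extChartAt 𝓘(ℝ, E) x₀).map_source h₀) ?_).of_le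
      two_le_infty
    rwa [(extChartAt 𝓘(ℝ, E) x₀).left_inv h₀]
  have h2 : HasFDerivAt (fderiv ℝ (chartTransition x₀ x₁)) _ (chartCurve x₀ x t : E) :=
    ((hψ.fderiv_right (m := 1) le_rfl).differentiableAt one_ne_zero).hasFDerivAt
  have h3 := h2.comp_hasDerivAt t
    (hasDerivAt_chartCurve hx.self_of_nhds h₀).differentiableAt.hasDerivAt
  exact (h3.clm_apply hd.hasDerivAt).deriv

namespace GyroSystem

variable [FiniteDimensional ℝ E] (S : GyroSystem E M)

/-- Newton's equation for the system `S` holds along `x` at the time `t`. -/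
def NewtonAt (x : ℝ → M) (t : ℝ) : Prop :=
  ∀ ξ : E, S.newtonDefect (x t) (chartCurve (x t) x t) (deriv (chartCurve (x t) x) t)
    (deriv (deriv (chartCurve (x t) x)) t) ξ = 0

omit [FiniteDimensional ℝ E] in
variable {S} in
theorem NewtonAt.congr {x x' : ℝ → M} {t : ℝ} (h : S.NewtonAt x t) (hx : x =ᶠ[𝓝 t] x') :
    S.NewtonAt x' t := by
  intro ξ
  have h1 : (chartCurve (x' t) x' : ℝ → E) =ᶠ[𝓝 t] chartCurve (x' t) x := chartCurve_congr hx.symm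
  rw [h1.deriv.deriv_eq, h1.deriv_eq, h1.self_of_nhds, ← hx.self_of_nhds]
  exact h ξ

omit [FiniteDimensional ℝ E] in
theorem newtonDefect_unique {x₀ : M} {y v b b' : E}
    (hy : y ∈ (extChartAt 𝓘(ℝ, E) x₀).target) (hb : ∀ ξ, S.newtonDefect x₀ y v b ξ = 0)
    (hb' : ∀ ξ, S.newtonDefect x₀ y v b' ξ = 0) : b = b' := by
  refine bilin_injective (S.chartMetric_pos hy) fun ξ => ?_
  have h1 := hb ξ
  have h2 := hb' ξ
  simp only [newtonDefect, loweredAccel] at h1 h2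
  linarith

theorem exists_newtonDefect_eq_zero {x₀ : M} {y : E}
    (hy : y ∈ (extChartAt 𝓘(ℝ, E) x₀).target) (v : E) :
    ∃ b, ∀ ξ, S.newtonDefect x₀ y v b ξ = 0 := by
  let L : E →L[ℝ] ℝ := fderiv ℝ (S.chartMetric x₀) y v v
    - (1 / 2 : ℝ) • ((fderiv ℝ (S.chartMetric x₀) y).flip v).flip v
    + (S.κ.inChart x₀ y).toContinuousLinearMap ![v, 0] 1 + fderiv ℝ (S.chartPotential x₀) y
  refine ⟨(S.chartMetric x₀ y).inverse (-L), fun ξ => ?_⟩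
  have h : (S.κ.inChart x₀ y).toContinuousLinearMap ![v, 0] 1 ξ = S.κ.inChart x₀ y ![v, ξ] := by
    change S.κ.inChart x₀ y (Function.update ![v, 0] 1 ξ) = _
    congr 1
    ext i
    fin_cases i <;> simp
  rw [newtonDefect, loweredAccel, bilin_inverse_apply (S.chartMetric_pos hy), ← h]
  simp [L]
  ring

theorem isDynamics_iff (X : ∀ w : TangentBundle 𝓘(ℝ, E) M, TangentSpace 𝓘(ℝ, E).tangent w) :
    S.IsDynamics X ↔ ∀ w, (X w : E × E).1 = fibreVec w ∧
      ∀ ξ, S.newtonDefect w.proj (extChartAt 𝓘(ℝ, E) w.proj w.proj) (fibreVec w)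
        (X w : E × E).2 ξ = 0 :=
  forall_congr' fun w => S.dynamics_equation_iff w (X w)

/-- `IsMotion` asks for some dynamical field. Nondegeneracy of the metric provides one by a choice
at each point; no regularity of the field is required. -/
theorem exists_isDynamics :
    ∃ X : ∀ w : TangentBundle 𝓘(ℝ, E) M, TangentSpace 𝓘(ℝ, E).tangent w, S.IsDynamics X := by
  choose b hb using fun w : TangentBundle 𝓘(ℝ, E) M =>
    S.exists_newtonDefect_eq_zero (mem_extChartAt_target (I := 𝓘(ℝ, E)) w.proj) (fibreVec w)
  exact ⟨fun w => ((fibreVec w, b w) : E × E), (S.isDynamics_iff _).2 fun w => ⟨rfl, hb w⟩⟩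

/-- The fibre component of the field and the second derivative of the curve solve the same
nondegenerate linear equation, so the velocity lift is an integral curve. -/
theorem isMotion_of_newtonAt {x : ℝ → M} {J : Set ℝ} (hJ : IsOpen J)
    (hx : ContMDiffOn 𝓘(ℝ, ℝ) 𝓘(ℝ, E) 2 x J) (hN : ∀ t ∈ J, S.NewtonAt x t) : S.IsMotion x J := by
  obtain ⟨X, hX⟩ := S.exists_isDynamics
  refine ⟨X, hX, tangentLift E x, fun t ht => ?_, fun t _ => rfl⟩
  have hxt := hx.contMDiffAt (hJ.mem_nhds ht)
  have h1 := (S.isDynamics_iff X).1 hX (tangentLift E x t)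
  have h2 := hN t ht
  unfold NewtonAt at h2
  rw [deriv_chartCurve_self (hxt.mdifferentiableAt two_ne_zero)] at h2
  have h3 : (X (tangentLift E x t) : E × E) = (velocityVec E x t,
      deriv (deriv (chartCurve (x t) x : ℝ → E)) t) :=
    Prod.ext h1.1 (S.newtonDefect_unique (mem_extChartAt_target (I := 𝓘(ℝ, E)) (x t)) h1.2 h2)
  have h4 := hasMFDerivAt_tangentLift hxt
  rw [← h3] at h4
  exact h4.hasMFDerivWithinAt

end GyroSystem

end Motions

/-! ### Velocity lifts of motions and invariance of Newton's equation -/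

section Motions

variable {E : Type*} [NormedAddCommGroup E] [NormedSpace ℝ E]
  {M : Type*} [TopologicalSpace M] [ChartedSpace E M]

theorem tangentLift_congr {x x' : ℝ → M} {t : ℝ} (h : x =ᶠ[𝓝 t] x') :
    tangentLift E x t = tangentLift E x' t := by
  have key : ∀ (p q : M) (u v : E), p = q → u = v →
      (TotalSpace.mk' E p u : TangentBundle 𝓘(ℝ, E) M) = TotalSpace.mk' E q v := by
    rintro p q u v rfl rfl
    rfl
  exact key _ _ _ _ h.self_of_nhds (velocityVec_congr h)

/-- Mere differentiability of the lift gives second derivatives in every chart. This is what is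
available before a motion is known to be `C²`. -/
theorem hasMFDerivAt_chartCurve_prodMk_deriv [IsManifold 𝓘(ℝ, E) ∞ M] {x : ℝ → M} {t : ℝ}
    {Y : E × E}
    (h : HasMFDerivAt 𝓘(ℝ, ℝ) 𝓘(ℝ, E).tangent (tangentLift E x) t
      ((1 : ℝ →L[ℝ] ℝ).smulRight Y))
    (hx : ∀ᶠ s in 𝓝 t, MDifferentiableAt 𝓘(ℝ, ℝ) 𝓘(ℝ, E) x s) (w : TangentBundle 𝓘(ℝ, E) M)
    (ht : x t ∈ (extChartAt 𝓘(ℝ, E) w.proj).source) :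
    HasFDerivAt (fun s => ((chartCurve w.proj x s, deriv (chartCurve w.proj x) s) : E × E))
      ((show E × E →L[ℝ] E × E from mfderiv 𝓘(ℝ, E).tangent 𝓘(ℝ, E × E)
        (extChartAt 𝓘(ℝ, E).tangent w) (tangentLift E x t)).comp
        ((1 : ℝ →L[ℝ] ℝ).smulRight Y)) t := by
  have hmem : tangentLift E x t ∈ (extChartAt 𝓘(ℝ, E).tangent w).source := by
    rwa [tangentBundle_mem_extChartAt_source]
  rw [extChartAt_source] at hmem
  have h1 := (mdifferentiableAt_extChartAt (I := 𝓘(ℝ, E).tangent) hmem).hasMFDerivAt.comp t h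
  have h2 := h1.congr_of_eventuallyEq
    (f₁ := fun s => ((chartCurve w.proj x s, deriv (chartCurve w.proj x) s) : E × E)) ?_
  · exact h2.hasFDerivAt
  · filter_upwards [hx, eventually_mem_chart_source hx.self_of_nhds.continuousAt ht] with s hs hs'
    exact (tangentBundle_extChartAt_tangentLift w hs hs').symm

theorem differentiableAt_deriv_chartCurve [IsManifold 𝓘(ℝ, E) ∞ M] {x : ℝ → M} {t : ℝ} {Y : E × E}
    (h : HasMFDerivAt 𝓘(ℝ, ℝ) 𝓘(ℝ, E).tangent (tangentLift E x) t
      ((1 : ℝ →L[ℝ] ℝ).smulRight Y))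
    (hx : ∀ᶠ s in 𝓝 t, MDifferentiableAt 𝓘(ℝ, ℝ) 𝓘(ℝ, E) x s) {x₀ : M}
    (ht : x t ∈ (extChartAt 𝓘(ℝ, E) x₀).source) :
    DifferentiableAt ℝ (deriv (chartCurve x₀ x : ℝ → E)) t :=
  (hasMFDerivAt_chartCurve_prodMk_deriv h hx (TotalSpace.mk' E x₀ (0 : E)) ht).differentiableAt.snd

theorem deriv_deriv_chartCurve_self [IsManifold 𝓘(ℝ, E) ∞ M] {x : ℝ → M} {t : ℝ} {Y : E × E}
    (h : HasMFDerivAt 𝓘(ℝ, ℝ) 𝓘(ℝ, E).tangent (tangentLift E x) t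
      ((1 : ℝ →L[ℝ] ℝ).smulRight Y))
    (hx : ∀ᶠ s in 𝓝 t, MDifferentiableAt 𝓘(ℝ, ℝ) 𝓘(ℝ, E) x s) :
    deriv (deriv (chartCurve (x t) x : ℝ → E)) t = Y.2 := by
  have h1 := hasMFDerivAt_chartCurve_prodMk_deriv h hx (tangentLift E x t)
    (mem_extChartAt_source (x t))
  rw [mfderiv_extChartAt_self] at h1
  have h2 := h1.snd.hasDerivAt.deriv
  exact h2.trans (congrArg Prod.snd (one_smul ℝ Y))

namespace GyroSystem

variable [IsManifold 𝓘(ℝ, E) ∞ M] [FiniteDimensional ℝ E] (S : GyroSystem E M)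

/-- The dynamics yields Newton's equation at each time in the chart centred at the current point.
Continuity of the second derivative has to be tested in one fixed chart, and this invariance
transports the equation there. -/
theorem newtonDefect_transition {x₀ x₁ : M} {y : E} (hy : y ∈ (extChartAt 𝓘(ℝ, E) x₀).target)
    (hy' : (extChartAt 𝓘(ℝ, E) x₀).symm y ∈ (extChartAt 𝓘(ℝ, E) x₁).source) (v b ξ : E) :
    S.newtonDefect x₀ y v b ξ =
      S.newtonDefect x₁ (chartTransition x₀ x₁ y) (fderiv ℝ (chartTransition x₀ x₁) y v)
        (fderiv ℝ (fderiv ℝ (chartTransition x₀ x₁)) y v v + fderiv ℝ (chartTransition x₀ x₁) y b)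
        (fderiv ℝ (chartTransition x₀ x₁) y ξ) := by
  have hψ : ContDiffAt ℝ 2 (chartTransition x₀ x₁) y :=
    (contDiffAt_chartTransition hy hy').of_le two_le_infty
  have hy₁ : chartTransition x₀ x₁ y ∈ (extChartAt 𝓘(ℝ, E) x₁).target :=
    (extChartAt 𝓘(ℝ, E) x₁).map_source hy'
  have hev := eventually_mem_extChartAt_target (isOpen_extChartAt_source x₁) hy hy'
  have h1 := loweredAccel_pullback hψ (S.differentiableAt_chartMetric hy)
    (S.differentiableAt_chartMetric hy₁) (S.chartMetric_symm _ _)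
    (hev.mono fun z hz u v => BilinField.inChart_transition S.metric.inner hz.1 hz.2 u v) v b ξ
  have h2 : S.κ.inChart x₀ y ![v, ξ] = S.κ.inChart x₁ (chartTransition x₀ x₁ y)
      ![fderiv ℝ (chartTransition x₀ x₁) y v, fderiv ℝ (chartTransition x₀ x₁) y ξ] := by
    rw [fderiv_chartTransition hy hy', fderiv_chartTransition hy hy']
    exact (S.κ.inChart_apply x₀ y v ξ).trans (S.κ.inChart_chartDeriv hy' _ _).symm
  have h3 : S.chartPotential x₀ =ᶠ[𝓝 y] S.chartPotential x₁ ∘ chartTransition x₀ x₁ := by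
    filter_upwards [hev] with z hz
    simp only [chartPotential, chartTransition, Function.comp_apply,
      (extChartAt 𝓘(ℝ, E) x₁).left_inv hz.2]
  have h4 := fderiv_comp y (S.differentiableAt_chartPotential hy₁)
    (hψ.differentiableAt two_ne_zero)
  rw [newtonDefect, newtonDefect, h1, h2, h3.fderiv_eq, h4]
  rfl

variable {S}

/-- The field is second order: its base component at `w` is `w`. Hence an integral curve coincides
with the velocity lift of its projection. -/
theorem IsMotion.exists_hasMFDerivAt_tangentLift {x : ℝ → M} {J : Set ℝ} (hJ : IsOpen J)
    (hx : S.IsMotion x J) : ∀ t ∈ J, ∃ Y : E × E,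
      HasMFDerivAt 𝓘(ℝ, ℝ) 𝓘(ℝ, E).tangent (tangentLift E x) t ((1 : ℝ →L[ℝ] ℝ).smulRight Y) ∧
      ∀ ξ, S.newtonDefect (x t) (chartCurve (x t) x t) (velocityVec E x t) Y.2 ξ = 0 := by
  obtain ⟨X, hX, w, hw, hwx⟩ := hx
  have hev : ∀ t ∈ J, x =ᶠ[𝓝 t] fun s => (w s).proj := fun t ht => by
    filter_upwards [hJ.mem_nhds ht] with s hs
    exact (hwx s hs).symm
  have hlift : ∀ t ∈ J, tangentLift E x t = w t := fun t ht => by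
    rw [tangentLift_congr (hev t ht)]
    have h1 := (mdifferentiable_tangentBundle_proj (w t)).hasMFDerivAt.comp t
      ((hw t ht).hasMFDerivAt (hJ.mem_nhds ht))
    have h2 : velocityVec E (fun s => (w s).proj) t = fibreVec (w t) := by
      refine Eq.trans ?_
        ((dproj_apply (w t) (X (w t))).trans ((S.isDynamics_iff X).1 hX (w t)).1)
      refine (DFunLike.congr_fun h1.mfderiv (1 : ℝ)).trans ?_
      exact congrArg (dproj (w t)) (one_smul ℝ (X (w t)))
    exact congrArg (TotalSpace.mk' E (w t).proj) h2
  intro t ht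
  have h1 := (S.isDynamics_iff X).1 hX (tangentLift E x t)
  refine ⟨X (tangentLift E x t), ?_, h1.2⟩
  have h2 := ((hw t ht).hasMFDerivAt (hJ.mem_nhds ht)).congr_of_eventuallyEq
    (f₁ := tangentLift E x) (by
      filter_upwards [hJ.mem_nhds ht] with s hs
      exact hlift s hs)
  rw [← hlift t ht] at h2
  exact h2

end GyroSystem

end Motions

/-! ### Motions are of class `C²` -/

section Regularity

variable {E : Type*} [NormedAddCommGroup E] [NormedSpace ℝ E] [FiniteDimensional ℝ E]
  {M : Type*} [TopologicalSpace M] [ChartedSpace E M] [IsManifold 𝓘(ℝ, E) ∞ M]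
  {S : GyroSystem E M} {x : ℝ → M} {J : Set ℝ}

namespace GyroSystem

theorem IsMotion.mdifferentiableAt (hJ : IsOpen J) (hx : S.IsMotion x J) {t : ℝ} (ht : t ∈ J) :
    MDifferentiableAt 𝓘(ℝ, ℝ) 𝓘(ℝ, E) x t := by
  obtain ⟨Y, hY, -⟩ := hx.exists_hasMFDerivAt_tangentLift hJ t ht
  exact (mdifferentiable_tangentBundle_proj (tangentLift E x t)).comp t hY.mdifferentiableAt

theorem IsMotion.eventually_mdifferentiableAt (hJ : IsOpen J) (hx : S.IsMotion x J) {t : ℝ}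
    (ht : t ∈ J) : ∀ᶠ s in 𝓝 t, MDifferentiableAt 𝓘(ℝ, ℝ) 𝓘(ℝ, E) x s := by
  filter_upwards [hJ.mem_nhds ht] with s hs
  exact hx.mdifferentiableAt hJ hs

theorem IsMotion.newtonAt (hJ : IsOpen J) (hx : S.IsMotion x J) : ∀ t ∈ J, S.NewtonAt x t := by
  intro t ht ξ
  obtain ⟨Y, hY, hN⟩ := hx.exists_hasMFDerivAt_tangentLift hJ t ht
  rw [deriv_chartCurve_self (hx.mdifferentiableAt hJ ht),
    deriv_deriv_chartCurve_self hY (hx.eventually_mdifferentiableAt hJ ht)]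
  exact hN ξ

theorem IsMotion.newtonDefect_chartCurve (hJ : IsOpen J) (hx : S.IsMotion x J) {x₀ : M} {t : ℝ}
    (ht : t ∈ J) (h₀ : x t ∈ (extChartAt 𝓘(ℝ, E) x₀).source) (ξ : E) :
    S.newtonDefect x₀ (chartCurve x₀ x t) (deriv (chartCurve x₀ x) t)
      (deriv (deriv (chartCurve x₀ x)) t) ξ = 0 := by
  obtain ⟨Y, hY, -⟩ := hx.exists_hasMFDerivAt_tangentLift hJ t ht
  have hev := hx.eventually_mdifferentiableAt hJ ht
  have h₁ := mem_extChartAt_source (I := 𝓘(ℝ, E)) (x t)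
  have hsymm : (extChartAt 𝓘(ℝ, E) x₀).symm (chartCurve x₀ x t : E) = x t :=
    (extChartAt 𝓘(ℝ, E) x₀).left_inv h₀
  have h1 : fderiv ℝ (chartTransition x₀ (x t)) (chartCurve x₀ x t : E)
      (deriv (chartCurve x₀ x) t) = deriv (chartCurve (x t) x) t := by
    rw [(hasDerivAt_chartCurve hev.self_of_nhds h₀).deriv,
      (hasDerivAt_chartCurve hev.self_of_nhds h₁).deriv]
    exact fderiv_chartTransition_chartDeriv h₀ h₁ _
  rw [S.newtonDefect_transition (x₁ := x t) (y := chartCurve x₀ x t) ((extChartAt 𝓘(ℝ, E) x₀).map_source h₀)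
    (by rw [hsymm]; exact h₁), h1, ← deriv_deriv_chartCurve_transition hev h₀ h₁
      (differentiableAt_deriv_chartCurve hY hev h₀), chartCurve_transition h₀]
  exact hx.newtonAt hJ t ht _

-- The equation says that `G(q) b` is a covector depending continuously on `q` and `v`; applying
-- `G(q)⁻¹`, which is continuous in `q` because inversion is continuous at invertible operators,
-- recovers `b`.
set_option maxSynthPendingDepth 5 in
theorem continuousOn_of_newtonDefect {x₀ : M} {q v b : ℝ → E} {U : Set ℝ}
    (hq : ContinuousOn q U) (hv : ContinuousOn v U)
    (hmem : ∀ t ∈ U, q t ∈ (extChartAt 𝓘(ℝ, E) x₀).target)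
    (h : ∀ t ∈ U, ∀ ξ, S.newtonDefect x₀ (q t) (v t) (b t) ξ = 0) : ContinuousOn b U := by
  have hG : ContinuousOn (fun t => S.chartMetric x₀ (q t)) U :=
    (S.contDiffOn_chartMetric x₀).continuousOn.comp hq hmem
  have hDG : ContinuousOn (fun t => fderiv ℝ (S.chartMetric x₀) (q t)) U :=
    ((S.contDiffOn_chartMetric x₀).continuousOn_fderiv_of_isOpen
      (isOpen_extChartAt_target x₀) (by simp)).comp hq hmem
  have hDV : ContinuousOn (fun t => fderiv ℝ (S.chartPotential x₀) (q t)) U :=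
    ((S.contDiffOn_chartPotential x₀).continuousOn_fderiv_of_isOpen
      (isOpen_extChartAt_target x₀) (by simp)).comp hq hmem
  have hκ : ContinuousOn (fun t => S.κ.inChart x₀ (q t)) U :=
    (S.κ_smooth.continuousOn_inChart x₀).comp hq hmem
  have hGb : ContinuousOn (fun t => S.chartMetric x₀ (q t) (b t)) U := by
    refine continuousOn_clm_apply.2 fun ξ => ?_
    have h1 : ContinuousOn (fun t => -(fderiv ℝ (S.chartMetric x₀) (q t) (v t) (v t) ξ
        - (1 / 2 : ℝ) * fderiv ℝ (S.chartMetric x₀) (q t) ξ (v t) (v t)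
        + S.κ.inChart x₀ (q t) ![v t, ξ] + fderiv ℝ (S.chartPotential x₀) (q t) ξ)) U := by
      have h2 := ((hDG.clm_apply hv).clm_apply hv).clm_apply (continuousOn_const (c := ξ))
      have h3 := ((hDG.clm_apply (continuousOn_const (c := ξ))).clm_apply hv).clm_apply hv
      have h4 : ContinuousOn (fun t => S.κ.inChart x₀ (q t) ![v t, ξ]) U := by
        refine hκ.eval ?_
        fun_prop
      have h5 := hDV.clm_apply (continuousOn_const (c := ξ))
      exact (((h2.sub (h3.const_smul (1 / 2 : ℝ))).add h4).add h5).neg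
    refine h1.congr fun t ht => ?_
    have h2 := h t ht ξ
    simp only [newtonDefect, loweredAccel] at h2
    linarith
  have hinv : ContinuousOn (fun t => (S.chartMetric x₀ (q t)).inverse) U := fun t ht => by
    obtain ⟨e, he⟩ := bilin_isInvertible (S.chartMetric_pos (hmem t ht))
    have h1 := (contDiffAt_map_inverse (n := 0) e).continuousAt
    rw [he] at h1
    exact ContinuousAt.comp_continuousWithinAt (f := fun t => S.chartMetric x₀ (q t)) h1 (hG t ht)
  refine (hinv.clm_apply hGb).congr fun t ht => ?_
  exact ((bilin_isInvertible (S.chartMetric_pos (hmem t ht))).inverse_apply_eq.2 rfl).symm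

theorem IsMotion.contMDiffOn (hJ : IsOpen J) (hx : S.IsMotion x J) :
    ContMDiffOn 𝓘(ℝ, ℝ) 𝓘(ℝ, E) 2 x J := by
  intro t₀ ht₀
  have hc : ContinuousOn x J := fun t ht =>
    (hx.mdifferentiableAt hJ ht).continuousAt.continuousWithinAt
  refine (contMDiffAt_two_of_chartCurve (hc.continuousAt (hJ.mem_nhds ht₀)) ?_).contMDiffWithinAt
  set U := J ∩ x ⁻¹' (extChartAt 𝓘(ℝ, E) (x t₀)).source with hUdef
  have hU : IsOpen U := hc.isOpen_inter_preimage hJ (isOpen_extChartAt_source (x t₀))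
  have hq : DifferentiableOn ℝ (chartCurve (x t₀) x : ℝ → E) U := fun t ht =>
    (hasDerivAt_chartCurve (hx.mdifferentiableAt hJ ht.1)
      ht.2).differentiableAt.differentiableWithinAt
  have hv : DifferentiableOn ℝ (deriv (chartCurve (x t₀) x : ℝ → E)) U := fun t ht => by
    obtain ⟨Y, hY, -⟩ := hx.exists_hasMFDerivAt_tangentLift hJ t ht.1
    exact (differentiableAt_deriv_chartCurve hY (hx.eventually_mdifferentiableAt hJ ht.1)
      ht.2).differentiableWithinAt
  have hb : ContinuousOn (deriv (deriv (chartCurve (x t₀) x : ℝ → E))) U :=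
    continuousOn_of_newtonDefect hq.continuousOn hv.continuousOn
      (fun t ht => (extChartAt 𝓘(ℝ, E) (x t₀)).map_source ht.2)
      fun t ht => hx.newtonDefect_chartCurve hJ ht.1 ht.2
  have h1 : ContDiffOn ℝ 1 (deriv (chartCurve (x t₀) x : ℝ → E)) U := by
    rw [show (1 : WithTop ℕ∞) = 0 + 1 from rfl, contDiffOn_succ_iff_deriv_of_isOpen hU]
    exact ⟨hv, by simp, contDiffOn_zero.2 hb⟩
  have h2 : ContDiffOn ℝ 2 (chartCurve (x t₀) x : ℝ → E) U := by
    rw [show (2 : WithTop ℕ∞) = 1 + 1 from rfl, contDiffOn_succ_iff_deriv_of_isOpen hU]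
    exact ⟨hq, by simp, h1⟩
  exact h2.contDiffAt (hU.mem_nhds ⟨ht₀, mem_extChartAt_source _⟩)

end GyroSystem

end Regularity

/-! ### The Jacobi metric and the curvature equation -/

section Jacobi

variable {E : Type*} [NormedAddCommGroup E] [NormedSpace ℝ E]
  {M : Type*} [TopologicalSpace M] [ChartedSpace E M] [IsManifold 𝓘(ℝ, E) ∞ M]

/-- The covariant acceleration of a curve, regarded as a vector of `E`. -/
def covAccelVec (g : BilinField E M) (y : ℝ → M) (τ : ℝ) : E :=
  covDerivAlong g y (velocity E y) τ

theorem covAccelVec_eq (g : BilinField E M) {y : ℝ → M} {τ : ℝ}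
    (hy : ContMDiffAt 𝓘(ℝ, ℝ) 𝓘(ℝ, E) 2 y τ) :
    covAccelVec g y τ =
      deriv (deriv (chartCurve (y τ) y)) τ +
        christoffel (g.inChart (y τ)) (chartCurve (y τ) y τ) (deriv (chartCurve (y τ) y) τ)
          (deriv (chartCurve (y τ) y) τ) := by
  have hev : (fun s => chartDeriv E (y τ) (y s) (velocityVec E y s)) =ᶠ[𝓝 τ]
      deriv (chartCurve (y τ) y : ℝ → E) := by
    filter_upwards [eventually_mdifferentiableAt hy, eventually_mem_chart_source (E := E)
      hy.continuousAt (mem_extChartAt_source (y τ))] with s hs hs'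
    exact (hasDerivAt_chartCurve hs hs').deriv.symm
  have h1 : covAccelVec g y τ = (chartDeriv E (y τ) (y τ)).inverse
      (deriv (fun s => chartDeriv E (y τ) (y s) (velocityVec E y s)) τ +
        christoffel (g.inChart (y τ)) (chartCurve (y τ) y τ) (deriv (chartCurve (y τ) y) τ)
          (chartDeriv E (y τ) (y τ) (velocityVec E y τ))) := rfl
  rw [h1, hev.deriv_eq, chartDeriv_self, ContinuousLinearMap.inverse_id,
    deriv_chartCurve_self (hy.mdifferentiableAt two_ne_zero)]
  rfl

namespace GyroSystem

variable (S : GyroSystem E M) (h : ℝ)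

/-- The conformal factor `2 (h - V)` of the Jacobi metric, in the preferred chart around `x₀`. -/
def chartFactor (x₀ : M) : E → ℝ := fun z => 2 * (h - S.chartPotential x₀ z)

theorem jacobiMetric_inChart (x₀ : M) :
    (S.jacobiMetric h).inChart x₀ = fun z => S.chartFactor h x₀ z • S.chartMetric x₀ z := rfl

theorem chartFactor_chartCurve {x₀ : M} {y : ℝ → M} {τ : ℝ}
    (hτ : y τ ∈ (extChartAt 𝓘(ℝ, E) x₀).source) :
    S.chartFactor h x₀ (chartCurve x₀ y τ) = 2 * (h - S.V (y τ)) := by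
  simp only [chartFactor, chartPotential, chartCurve, Function.comp_apply,
    (extChartAt 𝓘(ℝ, E) x₀).left_inv hτ]

theorem hasFDerivAt_chartFactor {x₀ : M} {z : E} (hz : z ∈ (extChartAt 𝓘(ℝ, E) x₀).target) :
    HasFDerivAt (S.chartFactor h x₀) ((-2 : ℝ) • fderiv ℝ (S.chartPotential x₀) z) z := by
  have h1 := ((S.differentiableAt_chartPotential hz).hasFDerivAt.const_sub h).const_mul (2 : ℝ)
  refine h1.congr_fderiv ?_
  rw [neg_smul, smul_neg]

theorem jacobiMetric_pos {x : M} (hx : S.V x < h) (v : E) (hv : v ≠ 0) :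
    0 < (S.jacobiMetric h).form x v v :=
  mul_pos (by linarith) (S.metric.pos x v hv)

variable [FiniteDimensional ℝ E]

/-- Both sides of `(*)` are lowered with `m_h`, which is positive definite at points with `V < h`.
This removes the inverse metric from the Christoffel symbols and from `Π_h`. -/
theorem curvatureEquation_iff {y : ℝ → M} {τ : ℝ} (hy : ContMDiffAt 𝓘(ℝ, ℝ) 𝓘(ℝ, E) 2 y τ)
    (hV : S.V (y τ) < h) :
    covDerivAlong (S.jacobiMetric h) y (velocity E y) τ =
        -(S.jacobiMetric h).sharp (S.κ.interior (velocity E y τ)) ↔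
      ∀ ξ : E, loweredAccel (fun z => S.chartFactor h (y τ) z • S.chartMetric (y τ) z)
        (chartCurve (y τ) y τ) (deriv (chartCurve (y τ) y) τ) (deriv (deriv (chartCurve (y τ) y)) τ)
        ξ + S.κ.inChart (y τ) (chartCurve (y τ) y τ) ![deriv (chartCurve (y τ) y) τ, ξ] = 0 := by
  have hpos := S.jacobiMetric_pos h hV
  have hself := BilinField.inChart_self (S.jacobiMetric h) (y τ)
  have hpos' : ∀ v : E, v ≠ 0 →
      0 < (S.jacobiMetric h).inChart (y τ) (chartCurve (y τ) y τ) v v := fun v hv => by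
    rw [chartCurve, hself]
    exact hpos v hv
  have hκ : ∀ ξ : E, S.κ.inChart (y τ) (chartCurve (y τ) y τ)
      ![deriv (chartCurve (y τ) y) τ, ξ] = S.κ.form (y τ) (velocityVec E y τ) ξ := fun ξ => by
    rw [deriv_chartCurve_self (hy.mdifferentiableAt two_ne_zero)]
    have := S.κ.inChart_chartDeriv (mem_extChartAt_source (I := 𝓘(ℝ, E)) (y τ))
      (velocityVec E y τ) ξ
    rwa [chartDeriv_self] at this
  have hsharp : ∀ ξ : E, (S.jacobiMetric h).form (y τ)
      ((S.jacobiMetric h).sharp (S.κ.interior (velocity E y τ))) ξ =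
        S.κ.form (y τ) (velocityVec E y τ) ξ := fun ξ =>
    ((S.jacobiMetric h).sharp_spec hpos _ ξ).trans (S.κ.interior_apply (velocity E y τ) ξ)
  have hacc : ∀ ξ : E, (S.jacobiMetric h).form (y τ)
      (covAccelVec (S.jacobiMetric h) y τ) ξ =
        loweredAccel (fun z => S.chartFactor h (y τ) z • S.chartMetric (y τ) z)
        (chartCurve (y τ) y τ) (deriv (chartCurve (y τ) y) τ) (deriv (deriv (chartCurve (y τ) y)) τ)
        ξ := fun ξ => by
    rw [← S.jacobiMetric_inChart, ← bilin_add_christoffel hpos', ← covAccelVec_eq _ hy,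
      chartCurve, hself]
  simp only [← hacc, hκ, ← hsharp]
  have hneg : ∀ ξ : E, (S.jacobiMetric h).form (y τ)
      (-((S.jacobiMetric h).sharp (S.κ.interior (velocity E y τ)) : E)) ξ =
        -(S.jacobiMetric h).form (y τ)
          ((S.jacobiMetric h).sharp (S.κ.interior (velocity E y τ))) ξ := fun ξ =>
    DFunLike.congr_fun (map_neg ((S.jacobiMetric h).form (y τ))
      ((S.jacobiMetric h).sharp (S.κ.interior (velocity E y τ)) : E)) ξ
  constructor
  · intro heq ξ
    refine add_eq_zero_iff_eq_neg.2 (Eq.trans ?_ (hneg ξ))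
    exact congrArg (fun a : E => (S.jacobiMetric h).form (y τ) a ξ) heq
  · intro hξ
    exact bilin_injective hpos fun ξ => (add_eq_zero_iff_eq_neg.1 (hξ ξ)).trans (hneg ξ).symm

/-- A curve and its reparametrization by arclength of the Jacobi metric: Newton's equation for the
former is the curvature equation for the latter. -/
theorem newtonAt_comp_iff {y : ℝ → M} {s : ℝ → ℝ} {t : ℝ}
    (hy : ContMDiffAt 𝓘(ℝ, ℝ) 𝓘(ℝ, E) 2 y (s t)) (hV : S.V (y (s t)) < h)
    (hs : ∀ᶠ r in 𝓝 t, HasDerivAt s (2 * (h - S.V (y (s r)))) r)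
    (hspeed : (S.jacobiMetric h).form (y (s t)) (velocityVec E y (s t)) (velocityVec E y (s t))
      = 1) :
    S.NewtonAt (y ∘ s) t ↔ covDerivAlong (S.jacobiMetric h) y (velocity E y) (s t) =
        -(S.jacobiMetric h).sharp (S.κ.interior (velocity E y (s t))) := by
  rw [S.curvatureEquation_iff h hy hV]
  set x₀ := y (s t) with hx₀
  set η : ℝ → E := chartCurve x₀ y with hη
  have hsrc : y (s t) ∈ (extChartAt 𝓘(ℝ, E) x₀).source := mem_extChartAt_source _
  have htgt : η (s t) ∈ (extChartAt 𝓘(ℝ, E) x₀).target := mem_extChartAt_target _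
  have hη2 : ContDiffAt ℝ 2 η (s t) := contDiffAt_chartCurve hy hsrc
  have hη' : HasDerivAt (deriv η) (deriv (deriv η) (s t)) (s t) :=
    (ContDiffAt.differentiableAt (ContDiffAt.derivWithin hη2 (m := 1) le_rfl)
      one_ne_zero).hasDerivAt
  have hsc : ContinuousAt s t := hs.self_of_nhds.continuousAt
  have hq : (chartCurve x₀ (y ∘ s) : ℝ → E) = η ∘ s := rfl
  -- Here `s' = f(η ∘ s)`. The identity must hold near `t`, since it is differentiated once more;
  -- this produces the `f df(η') η'` term of `hddq`, as required by `loweredAccel_conformal`.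
  have hdq : deriv (η ∘ s) =ᶠ[𝓝 t] fun r => S.chartFactor h x₀ (η (s r)) • deriv η (s r) := by
    filter_upwards [hs, hsc.eventually (eventually_mdifferentiableAt hy),
      hsc.eventually (eventually_mem_chart_source (E := E) hy.continuousAt hsrc)] with r hr hr₁ hr₂
    rw [S.chartFactor_chartCurve h hr₂]
    exact ((hasDerivAt_chartCurve hr₁ hr₂).differentiableAt.hasDerivAt.scomp r hr).deriv
  have hft : S.chartFactor h x₀ (η (s t)) = 2 * (h - S.V (y (s t))) :=
    S.chartFactor_chartCurve h hsrc
  have hf := S.hasFDerivAt_chartFactor h htgt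
  have hst : HasDerivAt s (S.chartFactor h x₀ (η (s t))) t := by
    rw [hft]
    exact hs.self_of_nhds
  have hηt : HasDerivAt η (deriv η (s t)) (s t) :=
    (hη2.differentiableAt two_ne_zero).hasDerivAt
  have hddq : deriv (deriv (η ∘ s)) t = S.chartFactor h x₀ (η (s t)) ^ 2 • deriv (deriv η) (s t) +
      (S.chartFactor h x₀ (η (s t)) * fderiv ℝ (S.chartFactor h x₀) (η (s t)) (deriv η (s t))) •
        deriv η (s t) := by
    rw [hdq.deriv_eq]
    have h1 := hf.differentiableAt.hasFDerivAt.comp_hasDerivAt t (hηt.scomp t hst)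
    have h2 := h1.smul (hη'.scomp t hst)
    refine h2.deriv.trans ?_
    simp only [Function.comp_apply, map_smul, smul_smul, smul_eq_mul, pow_two]
  have hunit : S.chartFactor h x₀ (η (s t)) *
      S.chartMetric x₀ (η (s t)) (deriv η (s t)) (deriv η (s t)) = 1 := by
    rw [← hspeed, ← BilinField.inChart_self, deriv_chartCurve_self
      (hy.mdifferentiableAt two_ne_zero)]
    rfl
  have hconf := loweredAccel_conformal (S.differentiableAt_chartMetric htgt) hf.differentiableAt
    hunit (deriv (deriv η) (s t))
  have hf0 : S.chartFactor h x₀ (η (s t)) ≠ 0 := by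
    rw [hft]
    linarith
  have hκ : ∀ ξ, S.κ.inChart x₀ (η (s t)) ![S.chartFactor h x₀ (η (s t)) • deriv η (s t), ξ] =
      S.chartFactor h x₀ (η (s t)) * S.κ.inChart x₀ (η (s t)) ![deriv η (s t), ξ] := fun ξ => by
    exact (S.κ.inChart x₀ (η (s t))).vecCons_smul ![ξ] _ _
  refine forall_congr' fun ξ => ?_
  -- Since `df = -2 dV`, the conformal correction `-df/2` is exactly the potential term `dV`, and
  -- the gyroscopic term carries one factor `f` by linearity in the velocity.
  have key : S.newtonDefect x₀ (η (s t)) (deriv (η ∘ s) t) (deriv (deriv (η ∘ s)) t) ξ =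
      S.chartFactor h x₀ (η (s t)) * (loweredAccel
        (fun z => S.chartFactor h x₀ z • S.chartMetric x₀ z) (η (s t)) (deriv η (s t))
          (deriv (deriv η) (s t)) ξ + S.κ.inChart x₀ (η (s t)) ![deriv η (s t), ξ]) := by
    rw [newtonDefect, mul_add, hconf, hddq, hdq.self_of_nhds, hκ, hf.fderiv]
    simp
    ring
  exact (Eq.congr_left key).trans (by simp [hf0])

end GyroSystem

end Jacobi

/-! ### Passing between time and Jacobi arclength -/

section Maupertuis

variable {E : Type*} [NormedAddCommGroup E] [NormedSpace ℝ E]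
  {M : Type*} [TopologicalSpace M] [ChartedSpace E M]

theorem velocityVec_comp {y : ℝ → M} {s : ℝ → ℝ} {t c : ℝ}
    (hy : MDifferentiableAt 𝓘(ℝ, ℝ) 𝓘(ℝ, E) y (s t)) (hs : HasDerivAt s c t) :
    velocityVec E (y ∘ s) t = c • velocityVec E y (s t) := by
  have h1 := (hy.hasMFDerivAt.comp t hs.hasFDerivAt.hasMFDerivAt).mfderiv
  refine (DFunLike.congr_fun h1 (1 : ℝ)).trans ?_
  have h2 : (ContinuousLinearMap.toSpanSingleton ℝ c : ℝ →L[ℝ] ℝ) 1 = c • (1 : ℝ) := by simp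
  exact (congrArg (show ℝ →L[ℝ] E from mfderiv 𝓘(ℝ, ℝ) 𝓘(ℝ, E) y (s t)) h2).trans
    (map_smul (show ℝ →L[ℝ] E from mfderiv 𝓘(ℝ, ℝ) 𝓘(ℝ, E) y (s t)) c 1)

variable [IsManifold 𝓘(ℝ, E) ∞ M]

namespace GyroSystem

variable (S : GyroSystem E M) (h : ℝ)

theorem jacobiMetric_form (x : M) (v : E) : (S.jacobiMetric h).form x v v =
    2 * (h - S.V x) * BilinField.form S.metric.inner x v v := rfl

theorem energy_velocity (x : ℝ → M) (t : ℝ) : S.energy ⟨x t, velocity E x t⟩ =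
    (1 / 2 : ℝ) * BilinField.form S.metric.inner (x t) (velocityVec E x t) (velocityVec E x t) +
      S.V (x t) := rfl

theorem speed_jacobiMetric (x : ℝ → M) (t : ℝ) : speed (S.jacobiMetric h) x t =
    Real.sqrt ((S.jacobiMetric h).form (x t) (velocityVec E x t) (velocityVec E x t)) := rfl

variable {S h}

theorem HasEnergy.jacobiMetric_form_velocity {x : ℝ → M} {J : Set ℝ} (hE : S.HasEnergy h x J)
    {t : ℝ} (ht : t ∈ J) :
    (S.jacobiMetric h).form (x t) (velocityVec E x t) (velocityVec E x t) =
      (2 * (h - S.V (x t))) ^ 2 := by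
  have h1 := hE t ht
  rw [energy_velocity] at h1
  rw [jacobiMetric_form]
  -- The energy relation gives `m(x', x') = 2(h - V)`; the conformal factor contributes the second
  -- power.
  linear_combination (4 * (h - S.V (x t))) * h1

theorem HasEnergy.speed_jacobiMetric {x : ℝ → M} {J : Set ℝ} (hE : S.HasEnergy h x J)
    {t : ℝ} (ht : t ∈ J) (hV : x t ∈ S.region h) :
    speed (S.jacobiMetric h) x t = 2 * (h - S.V (x t)) := by
  rw [S.speed_jacobiMetric, hE.jacobiMetric_form_velocity ht, Real.sqrt_sq]
  have : S.V (x t) < h := hV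
  linarith

theorem contDiffOn_factor_comp {x : ℝ → M} {J : Set ℝ}
    (hx : ContMDiffOn 𝓘(ℝ, ℝ) 𝓘(ℝ, E) 2 x J) :
    ContDiffOn ℝ 1 (fun t => 2 * (h - S.V (x t))) J := by
  have h1 : ContDiffOn ℝ 2 (S.V ∘ x) J :=
    ((S.V_smooth.of_le two_le_infty).comp_contMDiffOn hx).contDiffOn
  exact contDiffOn_const.mul (contDiffOn_const.sub (h1.of_le one_le_two))

variable [FiniteDimensional ℝ E]

theorem IsMotion.exists_isArclengthReparam {x : ℝ → M} {J : Set ℝ} (hJo : IsOpen J)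
    (hJc : J.OrdConnected) (hx : S.IsMotion x J) (hE : S.HasEnergy h x J)
    (hV : ∀ t ∈ J, x t ∈ S.region h) :
    ∃ (y : ℝ → M) (K : Set ℝ), IsArclengthReparam (S.jacobiMetric h) x J y K := by
  obtain ⟨s, hs⟩ := exists_primitive hJo hJc
    (contDiffOn_factor_comp (S := S) (h := h) (hx.contMDiffOn hJo)).continuousOn
  obtain ⟨σ, hσ, -⟩ := exists_leftInverse_of_hasDerivAt_pos hJo hJc hs fun t ht => by
    have : S.V (x t) < h := hV t ht
    linarith
  refine ⟨x ∘ σ, s '' J, s, fun t ht => ?_, rfl, fun t ht => congrArg x (hσ t ht)⟩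
  rw [hE.speed_jacobiMetric ht (hV t ht)]
  exact hs t ht

/-- On the energy level the arclength function has derivative `f > 0`, and its inverse `σ` solves
`σ' = 1 / f(x(σ))`. Hence `σ` is `C²`, and so is `y = x ∘ σ`. -/
theorem IsMotion.arclengthReparam {x : ℝ → M} {J : Set ℝ} (hJo : IsOpen J)
    (hJc : J.OrdConnected) (hx : S.IsMotion x J) (hE : S.HasEnergy h x J)
    (hV : ∀ t ∈ J, x t ∈ S.region h) {y : ℝ → M} {K : Set ℝ}
    (hy : IsArclengthReparam (S.jacobiMetric h) x J y K) :
    IsOpen K ∧ K.OrdConnected ∧ ContMDiffOn 𝓘(ℝ, ℝ) 𝓘(ℝ, E) 2 y K ∧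
      (∀ τ ∈ K, speed (S.jacobiMetric h) y τ = 1) ∧ S.CurvatureEquation h y K := by
  obtain ⟨s, hs, rfl, hys⟩ := hy
  have hs' : ∀ t ∈ J, HasDerivAt s (2 * (h - S.V (x t))) t := fun t ht => by
    rw [← hE.speed_jacobiMetric ht (hV t ht)]
    exact hs t ht
  have hpos : ∀ t ∈ J, 0 < 2 * (h - S.V (x t)) := fun t ht => by
    have : S.V (x t) < h := hV t ht
    linarith
  have hK := isOpen_image_of_hasDerivAt_pos hJo hJc hs' hpos
  have hx2 := hx.contMDiffOn hJo
  obtain ⟨σ, hσ, hσ'⟩ := exists_leftInverse_of_hasDerivAt_pos hJo hJc hs' hpos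
  have hmaps : MapsTo σ (s '' J) J := by
    rintro _ ⟨t, ht, rfl⟩
    rwa [hσ t ht]
  have hσ2 : ContDiffOn ℝ 2 σ (s '' J) :=
    contDiffOn_two_of_hasDerivAt_comp (p := fun t => (2 * (h - S.V (x t)))⁻¹) hK
      ((contDiffOn_factor_comp hx2).inv fun t ht => (hpos t ht).ne') hmaps (by
        rintro _ ⟨t, ht, rfl⟩
        rw [hσ t ht]
        exact hσ' t ht)
  have hyx : ∀ τ ∈ s '' J, y τ = (x ∘ σ) τ := by
    rintro _ ⟨t, ht, rfl⟩
    rw [hys t ht, Function.comp_apply, hσ t ht]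
  have hy2 : ContMDiffOn 𝓘(ℝ, ℝ) 𝓘(ℝ, E) 2 y (s '' J) :=
    (hx2.comp hσ2.contMDiffOn hmaps).congr hyx
  have hform : ∀ t ∈ J, (S.jacobiMetric h).form (y (s t)) (velocityVec E y (s t))
      (velocityVec E y (s t)) = 1 := fun t ht => by
    have hev : y =ᶠ[𝓝 (s t)] x ∘ σ := by
      filter_upwards [hK.mem_nhds (mem_image_of_mem s ht)] with τ hτ
      exact hyx τ hτ
    have hxd : MDifferentiableAt 𝓘(ℝ, ℝ) 𝓘(ℝ, E) x (σ (s t)) := by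
      rw [hσ t ht]
      exact hx.mdifferentiableAt hJo ht
    rw [velocityVec_congr hev, velocityVec_comp hxd (hσ' t ht), hys t ht, hσ t ht, map_smul,
      map_smul, smul_apply, hE.jacobiMetric_form_velocity ht, smul_eq_mul,
      smul_eq_mul]
    rw [sq, inv_mul_cancel_left₀ (hpos t ht).ne', inv_mul_cancel₀ (hpos t ht).ne']
  refine ⟨hK, ordConnected_image_of_hasDerivAt hJc hs', hy2, ?_, ?_⟩
  · rintro _ ⟨t, ht, rfl⟩
    rw [S.speed_jacobiMetric, hform t ht, Real.sqrt_one]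
  · rintro _ ⟨t, ht, rfl⟩
    -- Newton's equation is known for `x`, while the equivalence concerns `y ∘ s`; the two curves
    -- agree near `t`.
    have hev : x =ᶠ[𝓝 t] y ∘ s := by
      filter_upwards [hJo.mem_nhds ht] with r hr
      exact (hys r hr).symm
    refine (S.newtonAt_comp_iff h (hy2.contMDiffAt (hK.mem_nhds (mem_image_of_mem s ht))) ?_ ?_
      (hform t ht)).1 ((hx.newtonAt hJo t ht).congr hev)
    · rw [hys t ht]
      exact hV t ht
    · filter_upwards [hJo.mem_nhds ht] with r hr
      rw [hys r hr]
      exact hs' r hr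

theorem CurvatureEquation.exists_isMotion {y : ℝ → M} {K : Set ℝ} (hKo : IsOpen K)
    (hKc : K.OrdConnected) (hy : ContMDiffOn 𝓘(ℝ, ℝ) 𝓘(ℝ, E) 2 y K)
    (hV : ∀ τ ∈ K, y τ ∈ S.region h) (hspeed : ∀ τ ∈ K, speed (S.jacobiMetric h) y τ = 1)
    (hcurv : S.CurvatureEquation h y K) :
    ∃ (J : Set ℝ) (φ : ℝ → ℝ), IsOpen J ∧ J.OrdConnected ∧
      ContDiffOn ℝ 2 φ J ∧ (∀ t ∈ J, 0 < deriv φ t) ∧ φ '' J = K ∧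
      S.IsMotion (fun t => y (φ t)) J ∧ S.HasEnergy h (fun t => y (φ t)) J := by
  have hpos : ∀ τ ∈ K, 0 < 2 * (h - S.V (y τ)) := fun τ hτ => by
    have : S.V (y τ) < h := hV τ hτ
    linarith
  have hposinv : ∀ τ ∈ K, 0 < (2 * (h - S.V (y τ)))⁻¹ := fun τ hτ => inv_pos.2 (hpos τ hτ)
  have hfac := contDiffOn_factor_comp (S := S) (h := h) hy
  -- Time is recovered from `dt/dτ = 1/f`, and the required change of parameter is the inverse
  -- function of `T`.
  obtain ⟨T, hT⟩ := exists_primitive (g := fun τ => (2 * (h - S.V (y τ)))⁻¹) hKo hKc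
    (hfac.continuousOn.inv₀ fun τ hτ => (hpos τ hτ).ne')
  obtain ⟨φ, hφ, hφ'⟩ := exists_leftInverse_of_hasDerivAt_pos hKo hKc hT hposinv
  have hJ := isOpen_image_of_hasDerivAt_pos hKo hKc hT hposinv
  have hmaps : MapsTo φ (T '' K) K := by
    rintro _ ⟨τ, hτ, rfl⟩
    rwa [hφ τ hτ]
  have hφd : ∀ t ∈ T '' K, HasDerivAt φ (2 * (h - S.V (y (φ t)))) t := by
    rintro _ ⟨τ, hτ, rfl⟩
    have := hφ' τ hτ
    simp only [inv_inv] at this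
    rwa [hφ τ hτ]
  have hφ2 : ContDiffOn ℝ 2 φ (T '' K) := contDiffOn_two_of_hasDerivAt_comp hJ hfac hmaps hφd
  have hyat : ∀ t ∈ T '' K, ContMDiffAt 𝓘(ℝ, ℝ) 𝓘(ℝ, E) 2 y (φ t) := fun t ht =>
    hy.contMDiffAt (hKo.mem_nhds (hmaps ht))
  have hform : ∀ t ∈ T '' K, (S.jacobiMetric h).form (y (φ t)) (velocityVec E y (φ t))
      (velocityVec E y (φ t)) = 1 := fun t ht => by
    have h1 := hspeed (φ t) (hmaps ht)
    rwa [S.speed_jacobiMetric, Real.sqrt_eq_one] at h1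
  refine ⟨T '' K, φ, hJ, ordConnected_image_of_hasDerivAt hKc hT, hφ2, fun t ht => ?_, ?_, ?_,
    fun t ht => ?_⟩
  · rw [(hφd t ht).deriv]
    exact hpos _ (hmaps ht)
  · rw [image_image]
    exact (image_congr hφ).trans (image_id' K)
  · refine S.isMotion_of_newtonAt hJ (hy.comp hφ2.contMDiffOn hmaps) fun t ht => ?_
    refine (S.newtonAt_comp_iff h (hyat t ht) (hV _ (hmaps ht)) ?_ (hform t ht)).2
      (hcurv _ (hmaps ht))
    filter_upwards [hJ.mem_nhds ht] with r hr
    exact hφd r hr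
  · refine (S.energy_velocity (fun t => y (φ t)) t).trans ?_
    have h1 := velocityVec_comp ((hyat t ht).mdifferentiableAt two_ne_zero) (hφd t ht)
    have h2 := hform t ht
    rw [jacobiMetric_form] at h2
    have h3 : velocityVec E (fun t => y (φ t)) t = _ := h1
    rw [h3, map_smul, map_smul, smul_apply, smul_eq_mul, smul_eq_mul]
    -- The new velocity is `f y'`, so `K = f² m(y', y') / 2 = (f / 2) m_h(y', y') = h - V`.
    linear_combination (h - S.V (y (φ t))) * h2

end GyroSystem

end Maupertuis

end Gyro

end

theorem theorem2 {E : Type*} [NormedAddCommGroup E] [NormedSpace ℝ E] [FiniteDimensional ℝ E]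
    {M : Type*} [TopologicalSpace M] [ChartedSpace E M] [IsManifold 𝓘(ℝ, E) ∞ M]
    (S : Gyro.GyroSystem E M) (h : ℝ) :
    (∀ (x : ℝ → M) (J : Set ℝ), IsOpen J → J.OrdConnected →
      S.IsMotion x J → S.HasEnergy h x J → (∀ t ∈ J, x t ∈ S.region h) →
      (∃ (y : ℝ → M) (K : Set ℝ), Gyro.IsArclengthReparam (S.jacobiMetric h) x J y K) ∧
      ∀ (y : ℝ → M) (K : Set ℝ), Gyro.IsArclengthReparam (S.jacobiMetric h) x J y K →
        IsOpen K ∧ K.OrdConnected ∧ ContMDiffOn 𝓘(ℝ, ℝ) 𝓘(ℝ, E) 2 y K ∧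
        (∀ τ ∈ K, Gyro.speed (S.jacobiMetric h) y τ = 1) ∧
        S.CurvatureEquation h y K) ∧
    (∀ (y : ℝ → M) (K : Set ℝ), IsOpen K → K.OrdConnected →
      ContMDiffOn 𝓘(ℝ, ℝ) 𝓘(ℝ, E) 2 y K → (∀ τ ∈ K, y τ ∈ S.region h) →
      (∀ τ ∈ K, Gyro.speed (S.jacobiMetric h) y τ = 1) →
      S.CurvatureEquation h y K →
      ∃ (J : Set ℝ) (φ : ℝ → ℝ), IsOpen J ∧ J.OrdConnected ∧
        ContDiffOn ℝ 2 φ J ∧ (∀ t ∈ J, 0 < deriv φ t) ∧ φ '' J = K ∧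
        S.IsMotion (fun t => y (φ t)) J ∧ S.HasEnergy h (fun t => y (φ t)) J) :=
  ⟨fun _ _ hJo hJc hx hE hV => ⟨hx.exists_isArclengthReparam hJo hJc hE hV,
    fun _ _ hy => hx.arclengthReparam hJo hJc hE hV hy⟩,
    fun _ _ hKo hKc hy hV hspeed hcurv =>
      Gyro.GyroSystem.CurvatureEquation.exists_isMotion hKo hKc hy hV hspeed hcurv⟩
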